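/- Let $K$ be a field of arbitrary characteristic, let $n\ge 0$, $R=K[x_0,\dots,x_n]$ with the standard grading, let $I\subset R$ be a homogeneous ideal such that $A=R/I$ is artinian, and let $h_A(j)=\dim_K[A]_j$ be its Hilbert function. Suppose that $A$ has the Weak Lefschetz property, that is, there is an element $g\in[A]_1$ such that for every $j$ the multiplication map $\times g:[A]_j\to[A]_{j+1}$ has maximal rank (is injective or surjective). Let $\ell\ge 1$ and $u_1<u_2<\dots<u_\ell\le s$ be the integers with $$h_A(0)<\dots<h_A(u_1)=\dots=h_A(u_2-1)>h_A(u_2)=\dots=h_A(u_3-1)>\dots>h_A(u_\ell)=\dots=h_A(s)>0,$$ where $h_A(j)=0$ for $j>s$, and put $u_{\ell+1}:=s+1$ and $d:=u_1$. Assume that $$h_A(j)=\binom{n+j}{n}\ \text{ for all } j\le d,\qquad d\le u_2-3,\qquad u_k+2\le u_{k+1}\ \text{ for all } 2\le k\le \ell .$$ Then the graded Betti numbers $[\operatorname{tor}_i^R(A,K)]_{m}:=\dim_K[\operatorname{Tor}_i^R(A,K)]_{m}$ of $A$ are determined as follows: $[\operatorname{tor}_0^R(A,K)]_m$ is $1$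 if $m=0$ and $0$ otherwise, and for all integers $i\ge 1$ and $j$ $$[\operatorname{tor}_i^R(A,K)]_{i+j}=\begin{cases}\binom{d+i-1}{d}\binom{n+d}{i+d} & \text{if } j=d,\\[3pt] -\Delta h_A(u_k)\binom{n}{i-1} & \text{if } j=u_k-1 \text{ for some } 2\le k\le\ell+1,\\[3pt] 0 & \text{otherwise,}\end{cases}$$ where $\Delta h_A(j)=h_A(j)-h_A(j-1)$. -/

import Mathlib

open MvPolynomial

attribute [local instance] MvPolynomial.gradedAlgebra

namespace GradedBetti

/-! ### Hilbert function and Weak Lefschetz property of a standard graded quotient -/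

section Algebra

variable {K : Type*} [Field K] {n : ℕ}

/-- The graded piece `[R/I]_j` of `A = R/I`, where `R = K[x_0, …, x_n]`: the image in `R/I` of the
space of homogeneous polynomials of degree `j`. -/
noncomputable def piece (I : Ideal (MvPolynomial (Fin (n + 1)) K)) (j : ℕ) :
    Submodule K (MvPolynomial (Fin (n + 1)) K ⧸ I) :=
  (homogeneousSubmodule (Fin (n + 1)) K j).map (Ideal.Quotient.mkₐ K I).toLinearMap

/-- The Hilbert function `h_A(j) = dim_K [R/I]_j` of `A = R/I`. -/
noncomputable def hilbertFunction (I : Ideal (MvPolynomial (Fin (n + 1)) K)) (j : ℕ) : ℕ :=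
  Module.finrank K (piece I j)

/-- `A = R/I` has the Weak Lefschetz property: there is an element `g` of degree `1` in `A` such
that for all `j` multiplication by `g` from `[A]_j` to `[A]_{j+1}` has maximal rank, that is, it is
injective or surjective. -/
def HasWeakLefschetz (I : Ideal (MvPolynomial (Fin (n + 1)) K)) : Prop :=
  ∃ g ∈ piece I 1, ∀ j : ℕ,
    (∀ a ∈ piece I j, g * a = 0 → a = 0) ∨
    (∀ b ∈ piece I (j + 1), ∃ a ∈ piece I j, g * a = b)

end Algebra

/-- The first difference `Δh(j) = h(j) - h(j-1)`, with `h(-1) = 0`. -/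
def firstDifference (h : ℕ → ℕ) (j : ℕ) : ℤ :=
  (h j : ℤ) - (if j = 0 then 0 else (h (j - 1) : ℤ))

/-- The integers `u 1 < u 2 < ⋯ < u ℓ ≤ s` and `u (ℓ + 1) = s + 1` record the shape of `h`:
`h 0 < ⋯ < h (u 1) = ⋯ = h (u 2 - 1) > h (u 2) = ⋯ = h (u 3 - 1) > ⋯ > h (u ℓ) = ⋯ = h s > 0`,
and `h j = 0` for `j > s`. (The values `u 0` and `u k` with `k > ℓ + 1` are irrelevant.) -/
structure HasShape (h : ℕ → ℕ) (s ℓ : ℕ) (u : ℕ → ℕ) : Prop where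
  one_le : 1 ≤ ℓ
  last : u (ℓ + 1) = s + 1
  vanish : ∀ j, s < j → h j = 0
  increasing : ∀ j, j < u 1 → h j < h (j + 1)
  lt_next : ∀ k, 1 ≤ k → k ≤ ℓ → u k < u (k + 1)
  plateau : ∀ k, 1 ≤ k → k ≤ ℓ → ∀ j, u k ≤ j → j < u (k + 1) → h j = h (u k)
  drop : ∀ k, 1 ≤ k → k ≤ ℓ → h (u (k + 1)) < h (u k)

/-! ### Graded free resolutions and graded Betti numbers -/

section Resolution

variable {K : Type*} [Field K] {n : ℕ}

/-- `f` is homogeneous of degree `m ∈ ℤ` in the standard grading (so `f = 0` if `m < 0`). -/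
abbrev IsHomogeneousOfDegree (f : MvPolynomial (Fin (n + 1)) K) (m : ℤ) : Prop :=
  IsWeightedHomogeneous (fun _ => (1 : ℤ)) f m

/-- A graded free resolution
`⋯ → F_2 → F_1 → F_0 → R/I → 0` over `R = K[x_0, …, x_n]`,
where `F_i = ⨁_q R(-degree i q)` is a finitely generated graded free module, all maps are
homogeneous of degree zero, and the sequence is exact. The map `F_{i+1} → F_i` is given by the
matrix `d i`, and `F_0 → R/I` by the images `aug` of the basis elements. -/
structure GradedFreeResolution (I : Ideal (MvPolynomial (Fin (n + 1)) K)) where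
  rank : ℕ → ℕ
  degree : ∀ i, Fin (rank i) → ℤ
  d : ∀ i, Matrix (Fin (rank i)) (Fin (rank (i + 1))) (MvPolynomial (Fin (n + 1)) K)
  aug : Fin (rank 0) → MvPolynomial (Fin (n + 1)) K ⧸ I
  d_homogeneous : ∀ i p q, IsHomogeneousOfDegree (d i p q) (degree (i + 1) q - degree i p)
  aug_homogeneous : ∀ p, ∃ f, IsHomogeneousOfDegree f (degree 0 p) ∧
    Ideal.Quotient.mk I f = aug p
  aug_surjective : Function.Surjective
    (Fintype.linearCombination (MvPolynomial (Fin (n + 1)) K) aug)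
  exact_zero : LinearMap.range (d 0).mulVecLin =
    LinearMap.ker (Fintype.linearCombination (MvPolynomial (Fin (n + 1)) K) aug)
  exact_succ : ∀ i, LinearMap.range (d (i + 1)).mulVecLin = LinearMap.ker (d i).mulVecLin

namespace GradedFreeResolution

variable {I : Ideal (MvPolynomial (Fin (n + 1)) K)} (F : GradedFreeResolution I)

/-- The degree `m` part of the map `F_{i+1} ⊗_R K → F_i ⊗_R K`, where `K = R/(x_0, …, x_n)`.
The space `[F_i ⊗_R K]_m` has as basis the basis elements of `F_i` of degree `m`, and the matrix
entries are reduced modulo `(x_0, …, x_n)`. -/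
noncomputable def dbar (i : ℕ) (m : ℤ) :
    Matrix {p : Fin (F.rank i) // F.degree i p = m}
      {q : Fin (F.rank (i + 1)) // F.degree (i + 1) q = m} K :=
  fun p q => constantCoeff (F.d i p.1 q.1)

/-- The degree `m` cycles of `F ⊗_R K` in homological degree `i`. -/
noncomputable def cycles : (i : ℕ) → (m : ℤ) →
    Submodule K ({p : Fin (F.rank i) // F.degree i p = m} → K)
  | 0, _ => ⊤
  | i + 1, m => LinearMap.ker (F.dbar i m).mulVecLin

/-- The degree `m` boundaries of `F ⊗_R K` in homological degree `i`. -/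
noncomputable def boundaries (i : ℕ) (m : ℤ) :
    Submodule K ({p : Fin (F.rank i) // F.degree i p = m} → K) :=
  LinearMap.range (F.dbar i m).mulVecLin

/-- The graded Betti number `[tor_i^R(R/I, K)]_m = dim_K [Tor_i^R(R/I, K)]_m`, computed as the
dimension of the degree `m` part of the homology of `F ⊗_R K`. -/
noncomputable def tor (i : ℕ) (m : ℤ) : ℕ :=
  Module.finrank K (F.cycles i m ⧸ (F.boundaries i m).submoduleOf (F.cycles i m))

end GradedFreeResolution

end Resolution

/-! ### Existence of graded free resolutions -/

section Existence

variable {K : Type*} [Field K] {n : ℕ}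

/-- The degree `m` component of a vector in `⨁_p R(-deg p)`. -/
noncomputable def vecComponent {b : ℕ} (deg : Fin b → ℤ) (m : ℤ)
    (v : Fin b → MvPolynomial (Fin (n + 1)) K) : Fin b → MvPolynomial (Fin (n + 1)) K :=
  fun p => weightedHomogeneousComponent (fun _ => (1 : ℤ)) (m - deg p) (v p)

theorem vecComponent_sum {b : ℕ} (deg : Fin b → ℤ) (v : Fin b → MvPolynomial (Fin (n + 1)) K) :
    ∃ J : Finset ℤ, v = ∑ m ∈ J, vecComponent deg m v := by
  classical
  refine ⟨Finset.univ.biUnion fun p => (v p).support.image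
    fun e => Finsupp.weight (fun _ => (1 : ℤ)) e + deg p, ?_⟩
  funext p
  ext e
  rw [Finset.sum_apply, coeff_sum]
  simp only [vecComponent, coeff_weightedHomogeneousComponent]
  rw [Finset.sum_eq_single (Finsupp.weight (fun _ => (1 : ℤ)) e + deg p)]
  · simp
  · intro m _ hm
    rw [if_neg]
    intro h
    exact hm (by rw [h]; ring)
  · intro hm
    have : e ∉ (v p).support := fun he => hm (Finset.mem_biUnion.2
      ⟨p, Finset.mem_univ _, Finset.mem_image.2 ⟨e, he, rfl⟩⟩)
    simp only [notMem_support_iff] at this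
    simp [this]

theorem exists_matrix {b : ℕ} (deg : Fin b → ℤ)
    (N : Submodule (MvPolynomial (Fin (n + 1)) K) (Fin b → MvPolynomial (Fin (n + 1)) K))
    (hN : ∀ v ∈ N, ∀ m, vecComponent deg m v ∈ N) :
    ∃ (b' : ℕ) (deg' : Fin b' → ℤ)
      (M : Matrix (Fin b) (Fin b') (MvPolynomial (Fin (n + 1)) K)),
      (∀ p q, IsHomogeneousOfDegree (M p q) (deg' q - deg p)) ∧
      LinearMap.range M.mulVecLin = N := by
  classical
  set H : Set (Fin b → MvPolynomial (Fin (n + 1)) K) :=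
    {v | v ∈ N ∧ ∃ m, ∀ p, IsHomogeneousOfDegree (v p) (m - deg p)} with hH
  have hspan : Submodule.span _ H = N := by
    apply le_antisymm
    · exact Submodule.span_le.2 fun v hv => hv.1
    · intro v hv
      obtain ⟨J, hJ⟩ := vecComponent_sum deg v
      rw [hJ]
      refine Submodule.sum_mem _ fun m _ => Submodule.subset_span ⟨hN v hv m, m, fun p => ?_⟩
      exact weightedHomogeneousComponent_isWeightedHomogeneous _ _
  have hfg : (Submodule.span (MvPolynomial (Fin (n + 1)) K) H).FG := IsNoetherian.noetherian _
  obtain ⟨T, hTH, hT⟩ := (Submodule.fg_span_iff_fg_span_finset_subset H).1 hfg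
  have hd : ∀ q : Fin T.card, ∃ m, ∀ p, IsHomogeneousOfDegree
      ((T.equivFin.symm q : Fin b → MvPolynomial (Fin (n + 1)) K) p) (m - deg p) :=
    fun q => (hTH (T.equivFin.symm q).2).2
  choose deg' hdeg' using hd
  refine ⟨T.card, deg', Matrix.of fun p q => (T.equivFin.symm q).1 p, fun p q => hdeg' q p, ?_⟩
  rw [Matrix.range_mulVecLin, ← hspan, hT]
  congr 1
  ext v
  constructor
  · rintro ⟨q, rfl⟩
    exact (T.equivFin.symm q).2
  · intro hv
    exact ⟨T.equivFin ⟨v, hv⟩, by funext p; simp [Matrix.col]⟩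

theorem component_mul {f g : MvPolynomial (Fin (n + 1)) K} {a k c : ℤ}
    (hf : IsHomogeneousOfDegree f a) (hc : c = a + k) :
    weightedHomogeneousComponent (fun _ => (1 : ℤ)) c (f * g) =
      f * weightedHomogeneousComponent (fun _ => (1 : ℤ)) k g := by
  subst hc
  let _ := weightedGradedAlgebra K (fun _ : Fin (n + 1) => (1 : ℤ))
  have := DirectSum.coe_decompose_mul_add_of_left_mem
    (weightedHomogeneousSubmodule K (fun _ : Fin (n + 1) => (1 : ℤ))) (i := a) (j := k)
    (a := f) (b := g) hf
  have h2 : ∀ (φ : MvPolynomial (Fin (n + 1)) K) (i : ℤ),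
      (DirectSum.decompose (weightedHomogeneousSubmodule K (fun _ : Fin (n + 1) => (1 : ℤ))) φ i :
        MvPolynomial (Fin (n + 1)) K) = weightedHomogeneousComponent (fun _ => (1 : ℤ)) i φ :=
    fun φ i => weightedDecomposition.decompose'_apply K _ φ i
  rw [h2, h2] at this
  exact this

theorem vecComponent_mulVec {b b' : ℕ} (deg : Fin b → ℤ) (deg' : Fin b' → ℤ)
    (M : Matrix (Fin b) (Fin b') (MvPolynomial (Fin (n + 1)) K))
    (hM : ∀ p q, IsHomogeneousOfDegree (M p q) (deg' q - deg p)) (m : ℤ)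
    (v : Fin b' → MvPolynomial (Fin (n + 1)) K) :
    M.mulVec (vecComponent deg' m v) = vecComponent deg m (M.mulVec v) := by
  funext p
  simp only [Matrix.mulVec, dotProduct, vecComponent, map_sum]
  exact Finset.sum_congr rfl fun q _ => (component_mul (hM p q) (by ring)).symm

/-- A homogeneous submodule of a finitely generated graded free module. -/
structure Stage (K : Type*) [Field K] (n : ℕ) where
  rank : ℕ
  deg : Fin rank → ℤ
  N : Submodule (MvPolynomial (Fin (n + 1)) K) (Fin rank → MvPolynomial (Fin (n + 1)) K)
  homog : ∀ v ∈ N, ∀ m, vecComponent deg m v ∈ N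

noncomputable def Stage.mat (S : Stage K n) :
    Matrix (Fin S.rank) (Fin (exists_matrix S.deg S.N S.homog).choose)
      (MvPolynomial (Fin (n + 1)) K) :=
  (exists_matrix S.deg S.N S.homog).choose_spec.choose_spec.choose

noncomputable def Stage.next (S : Stage K n) : Stage K n where
  rank := (exists_matrix S.deg S.N S.homog).choose
  deg := (exists_matrix S.deg S.N S.homog).choose_spec.choose
  N := LinearMap.ker S.mat.mulVecLin
  homog := by
    intro v hv m
    have h := (exists_matrix S.deg S.N S.homog).choose_spec.choose_spec.choose_spec.1
    rw [LinearMap.mem_ker, Matrix.mulVecLin_apply] at hv ⊢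
    have h2 := vecComponent_mulVec _ _ _ h m v
    change S.mat.mulVec _ = vecComponent _ m (S.mat.mulVec v) at h2
    rw [h2, hv]
    funext p
    simp [vecComponent]

/-- Every homogeneous ideal `I` has a graded free resolution of `R/I`. -/
theorem nonempty_gradedFreeResolution (I : Ideal (MvPolynomial (Fin (n + 1)) K))
    (hI : I.IsHomogeneous (homogeneousSubmodule (Fin (n + 1)) K)) :
    Nonempty (GradedFreeResolution I) := by
  classical
  let aug : Fin 1 → MvPolynomial (Fin (n + 1)) K ⧸ I := fun _ => 1
  have haug : ∀ v, Fintype.linearCombination (MvPolynomial (Fin (n + 1)) K) aug v =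
      Ideal.Quotient.mk I (v 0) := by
    intro v
    simp only [Fintype.linearCombination_apply, aug, Finset.univ_unique, Finset.sum_singleton]
    change Ideal.Quotient.mk I (v 0 * 1) = _
    rw [mul_one]
  let S0 : Stage K n :=
    { rank := 1
      deg := fun _ => 0
      N := LinearMap.ker (Fintype.linearCombination (MvPolynomial (Fin (n + 1)) K) aug)
      homog := by
        intro v hv m
        rw [LinearMap.mem_ker, haug, Ideal.Quotient.eq_zero_iff_mem] at hv ⊢
        simp only [vecComponent, sub_zero]
        have key : weightedHomogeneousComponent (fun _ => (1 : ℤ)) m (v 0) =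
            if 0 ≤ m then homogeneousComponent m.toNat (v 0) else 0 := by
          ext e
          have hw : Finsupp.weight (fun _ : Fin (n + 1) => (1 : ℤ)) e = (e.degree : ℤ) := by
            simp [Finsupp.weight_apply, Finsupp.degree_apply, Finsupp.sum]
          rw [coeff_weightedHomogeneousComponent, hw]
          split_ifs with h1 h2 h2
          · rw [coeff_homogeneousComponent, if_pos (by omega)]
          · omega
          · rw [coeff_homogeneousComponent, if_neg (by omega)]
          · simp
        rw [key]
        split_ifs
        · exact homogeneousComponent_mem_of_mem hI hv _
        · exact I.zero_mem }
  let st : ℕ → Stage K n := fun i => Nat.rec S0 (fun _ S => S.next) i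
  have hspec := fun S : Stage K n =>
    (exists_matrix S.deg S.N S.homog).choose_spec.choose_spec.choose_spec
  exact ⟨{
    rank := fun i => (st i).rank
    degree := fun i => (st i).deg
    d := fun i => (st i).mat
    aug := aug
    d_homogeneous := fun i => (hspec (st i)).1
    aug_homogeneous := fun p => ⟨1, isWeightedHomogeneous_one _ _, map_one _⟩
    aug_surjective := fun y => by
      obtain ⟨f, rfl⟩ := Ideal.Quotient.mk_surjective y
      exact ⟨fun _ => f, haug _⟩
    exact_zero := (hspec (st 0)).2
    exact_succ := fun i => (hspec (st (i + 1))).2 }⟩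

end Existence

end GradedBetti

/-! Let `g = y 0` be a Lefschetz form, completed to a basis `y 0, …, y n` of the linear forms, and
put `J k = (y 0, …, y (k-1))`. For any graded free resolution `F`, the homology of `F / J k F` is
`Tor(A, R / J k)`. It vanishes in positive degrees at `k = 0` and is `Tor(A, K)` at `k = n + 1`.
Multiplication by `y k` gives `0 → (F / J k F)(-1) → F / J k F → F / J (k+1) F → 0`, so the
dimensions at stage `k + 1` follow from those at stage `k` once the ranks of `y k` on homology are
known.

First step: since `I` has no nonzero element of degree at most `d` and maximal rank makes `g`
surjective onto degrees above `d`, the quotient `A / gA` is `K[z_1, …, z_n] / 𝔪^(d+1)`. The kernel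
of `g` becomes the first homology, shifted by one; it lives in the degrees `t = u k - 1`, `k ≥ 2`,
with dimension `h(t) - h(t + 1)`.

Later steps: homology in homological degree `j ≥ 1` sits only in degrees `j + d` and `j + t`. The
gap hypotheses say that no two of these degrees are consecutive, so every further linear form acts
as zero on positive homology. On `H_0` it is injective up to degree `d`, and nothing lies above.
Hence all ranks are forced, and the dimensions obey Pascal-type recursions: the kernel of `g`
contributes a Koszul factor `n.choose (i - 1)`, and `A / gA` contributes the linear resolution of a
power of the maximal ideal.

The exact sequences enter only as dimension counts (`homologyDim_sup_span_zero`,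
`homologyDim_sup_span_succ`); `homologyNumerics` collects the resulting integer relations, and
`HomologyNumerics.homology_succ` solves them. -/

namespace GradedBetti

/-! ### Graded pieces of submodules of free modules and dimension counts -/

section GradedParts

variable {K : Type*} [Field K] {n : ℕ}

local notation "Poly" => MvPolynomial (Fin (n + 1)) K

/-- The homogeneous component of integral degree `m`. -/
noncomputable abbrev comp (m : ℤ) :
    MvPolynomial (Fin (n + 1)) K →ₗ[K] MvPolynomial (Fin (n + 1)) K :=
  weightedHomogeneousComponent (fun _ => (1 : ℤ)) m

theorem weight_one_int (e : Fin (n + 1) →₀ ℕ) :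
    Finsupp.weight (fun _ : Fin (n + 1) => (1 : ℤ)) e = (e.degree : ℤ) := by
  simp [Finsupp.weight_apply, Finsupp.degree_apply, Finsupp.sum]

theorem isHomogeneousOfDegree_iff {f : Poly} {m : ℤ} :
    IsHomogeneousOfDegree f m ↔ ∀ e, coeff e f ≠ 0 → (e.degree : ℤ) = m := by
  simp only [← weight_one_int]
  exact ⟨fun h e he => h he, fun h e he => h e he⟩

theorem isHomogeneousOfDegree_natCast {f : Poly} {m : ℕ} :
    IsHomogeneousOfDegree f (m : ℤ) ↔ f.IsHomogeneous m := by
  rw [isHomogeneousOfDegree_iff]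
  constructor
  · intro h e he
    have := h e he
    rw [Finsupp.degree_eq_weight_one] at this
    exact_mod_cast this
  · intro h e he
    have := h he
    rw [Finsupp.degree_eq_weight_one]
    exact_mod_cast this

theorem IsHomogeneousOfDegree.eq_zero_of_neg {f : Poly} {m : ℤ}
    (hf : IsHomogeneousOfDegree f m) (hm : m < 0) : f = 0 := by
  rw [isHomogeneousOfDegree_iff] at hf
  ext e
  by_contra h
  have := hf e h
  omega

theorem constantCoeff_eq_zero {f : Poly} {m : ℤ}
    (hf : IsHomogeneousOfDegree f m) (hm : m ≠ 0) : constantCoeff f = 0 := by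
  rw [isHomogeneousOfDegree_iff] at hf
  by_contra h
  exact hm (by simpa using (hf 0 h).symm)

theorem comp_mem (m : ℤ) (f : Poly) : IsHomogeneousOfDegree (comp m f) m :=
  weightedHomogeneousComponent_isWeightedHomogeneous _ _

theorem comp_of_mem {m : ℤ} {f : Poly} (hf : IsHomogeneousOfDegree f m) : comp m f = f :=
  IsWeightedHomogeneous.weightedHomogeneousComponent_same hf

theorem comp_mul {f : Poly} {a c : ℤ} (hf : IsHomogeneousOfDegree f a) (g : Poly) :
    comp c (f * g) = f * comp (c - a) g :=
  component_mul hf (by ring)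

theorem comp_eq_ite (m : ℤ) (f : Poly) :
    comp m f = if 0 ≤ m then homogeneousComponent m.toNat f else 0 := by
  ext e
  rw [coeff_weightedHomogeneousComponent, weight_one_int]
  split_ifs with h1 h2 h2
  · rw [coeff_homogeneousComponent, if_pos (by omega)]
  · omega
  · rw [coeff_homogeneousComponent, if_neg (by omega)]
  · simp

/-- An ideal that is closed under taking homogeneous components. -/
def IsGradedIdeal (J : Ideal (MvPolynomial (Fin (n + 1)) K)) : Prop :=
  ∀ f ∈ J, ∀ m, comp m f ∈ J

theorem isGradedIdeal_of_isHomogeneous {I : Ideal Poly}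
    (hI : I.IsHomogeneous (homogeneousSubmodule (Fin (n + 1)) K)) : IsGradedIdeal I := by
  intro f hf m
  rw [comp_eq_ite]
  split_ifs
  · exact homogeneousComponent_mem_of_mem hI hf _
  · exact I.zero_mem

theorem IsGradedIdeal.bot : IsGradedIdeal (⊥ : Ideal Poly) := by
  intro f hf m
  rw [Ideal.mem_bot] at hf
  simp [hf]

theorem IsGradedIdeal.sup {I J : Ideal Poly} (hI : IsGradedIdeal I) (hJ : IsGradedIdeal J) :
    IsGradedIdeal (I ⊔ J) := by
  intro f hf m
  obtain ⟨a, ha, b, hb, rfl⟩ := Submodule.mem_sup.1 hf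
  rw [map_add]
  exact Submodule.add_mem_sup (hI a ha m) (hJ b hb m)

theorem IsGradedIdeal.span_singleton {y : Poly} {a : ℤ} (hy : IsHomogeneousOfDegree y a) :
    IsGradedIdeal (Ideal.span {y}) := by
  intro f hf m
  obtain ⟨g, rfl⟩ := Ideal.mem_span_singleton'.1 hf
  rw [mul_comm, comp_mul hy]
  exact Ideal.mul_mem_right _ _ (Ideal.mem_span_singleton_self y)

variable {b b' : ℕ} (deg : Fin b → ℤ) (deg' : Fin b' → ℤ)

/-- The degree `m` part of `⨁_p R(-deg p)`. -/
def gradedPart (m : ℤ) : Submodule K (Fin b → MvPolynomial (Fin (n + 1)) K) where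
  carrier := {v | ∀ p, IsHomogeneousOfDegree (v p) (m - deg p)}
  add_mem' hv hw p := (hv p).add (hw p)
  zero_mem' _ := isWeightedHomogeneous_zero _ _ _
  smul_mem' c _ hv p :=
    (weightedHomogeneousSubmodule K (fun _ : Fin (n + 1) => (1 : ℤ)) _).smul_mem c (hv p)

variable {deg deg'}

theorem mem_gradedPart {m : ℤ} {v : Fin b → Poly} :
    v ∈ gradedPart deg m ↔ ∀ p, IsHomogeneousOfDegree (v p) (m - deg p) := Iff.rfl

theorem vecComponent_apply (m : ℤ) (v : Fin b → Poly) (p : Fin b) :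
    vecComponent deg m v p = comp (m - deg p) (v p) := rfl

theorem vecComponent_mem (m : ℤ) (v : Fin b → Poly) : vecComponent deg m v ∈ gradedPart deg m :=
  fun _ => comp_mem _ _

theorem vecComponent_of_mem {m : ℤ} {v : Fin b → Poly} (hv : v ∈ gradedPart deg m) :
    vecComponent deg m v = v :=
  funext fun p => comp_of_mem (hv p)

theorem vecComponent_add (m : ℤ) (v w : Fin b → Poly) :
    vecComponent deg m (v + w) = vecComponent deg m v + vecComponent deg m w := by
  funext p
  simp [vecComponent_apply]

theorem vecComponent_smul {y : Poly} (hy : IsHomogeneousOfDegree y 1) (m : ℤ) (v : Fin b → Poly) :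
    vecComponent deg m (y • v) = y • vecComponent deg (m - 1) v := by
  funext p
  simp only [vecComponent_apply, Pi.smul_apply, smul_eq_mul]
  rw [comp_mul hy, sub_right_comm]

theorem finite_homogeneous (m : ℤ) :
    (weightedHomogeneousSubmodule K (fun _ : Fin (n + 1) => (1 : ℤ)) m).FG := by
  rcases lt_or_ge m 0 with hm | hm
  · convert Submodule.fg_bot
    exact (Submodule.eq_bot_iff _).2 fun f hf => IsHomogeneousOfDegree.eq_zero_of_neg hf hm
  · lift m to ℕ using hm
    convert homogeneousSubmodule_fg (Fin (n + 1)) K m using 1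
    ext f
    exact isHomogeneousOfDegree_natCast

instance gradedPart_finite (m : ℤ) :
    FiniteDimensional K (gradedPart (K := K) (n := n) deg m) := by
  have : gradedPart (K := K) (n := n) deg m = Submodule.pi Set.univ
      fun p => weightedHomogeneousSubmodule K (fun _ : Fin (n + 1) => (1 : ℤ)) (m - deg p) := by
    ext v
    simp [mem_gradedPart, Submodule.mem_pi]
  rw [this]
  exact Module.Finite.iff_fg.2 (Submodule.fg_pi fun p => finite_homogeneous _)

variable (deg) in
/-- A submodule closed under taking homogeneous components. -/
def IsGraded (N : Submodule (MvPolynomial (Fin (n + 1)) K)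
    (Fin b → MvPolynomial (Fin (n + 1)) K)) : Prop :=
  ∀ v ∈ N, ∀ m, vecComponent deg m v ∈ N

variable (deg) in
/-- The degree `m` part of a submodule of `⨁_p R(-deg p)`. -/
noncomputable def part (N : Submodule (MvPolynomial (Fin (n + 1)) K) (Fin b → MvPolynomial (Fin (n + 1)) K))
    (m : ℤ) : Submodule K (Fin b → MvPolynomial (Fin (n + 1)) K) :=
  gradedPart deg m ⊓ N.restrictScalars K

theorem mem_part {N : Submodule Poly (Fin b → Poly)} {m : ℤ} {v : Fin b → Poly} :
    v ∈ part deg N m ↔ v ∈ gradedPart deg m ∧ v ∈ N := Iff.rfl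

instance part_finite (N : Submodule Poly (Fin b → Poly)) (m : ℤ) :
    FiniteDimensional K (part deg N m) :=
  Submodule.finiteDimensional_of_le (inf_le_left : part deg N m ≤ gradedPart deg m)

theorem part_mono {N N' : Submodule Poly (Fin b → Poly)} (h : N ≤ N') (m : ℤ) :
    part deg N m ≤ part deg N' m :=
  inf_le_inf_left _ h

theorem part_top (m : ℤ) : part (K := K) (n := n) deg ⊤ m = gradedPart deg m := by
  ext v
  simp [mem_part]

/-- The vectors with all entries in the ideal `J`. -/
noncomputable def idealVec (b : ℕ) (J : Ideal (MvPolynomial (Fin (n + 1)) K)) :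
    Submodule (MvPolynomial (Fin (n + 1)) K) (Fin b → MvPolynomial (Fin (n + 1)) K) :=
  Submodule.pi Set.univ fun _ => J

theorem mem_idealVec {J : Ideal Poly} {v : Fin b → Poly} : v ∈ idealVec b J ↔ ∀ p, v p ∈ J := by
  simp [idealVec, Submodule.mem_pi]

theorem IsGraded.idealVec {J : Ideal Poly} (hJ : IsGradedIdeal J) :
    IsGraded deg (idealVec b J) := fun _ hv _ =>
  mem_idealVec.2 fun p => hJ _ (mem_idealVec.1 hv p) _

theorem IsGraded.sup {N N' : Submodule Poly (Fin b → Poly)} (hN : IsGraded deg N)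
    (hN' : IsGraded deg N') : IsGraded deg (N ⊔ N') := by
  intro f hf m
  obtain ⟨a, ha, b, hb, rfl⟩ := Submodule.mem_sup.1 hf
  rw [vecComponent_add]
  exact Submodule.add_mem_sup (hN a ha m) (hN' b hb m)

theorem idealVec_bot : idealVec (K := K) (n := n) b ⊥ = ⊥ := by
  ext v
  rw [mem_idealVec, Submodule.mem_bot, funext_iff]
  rfl

theorem idealVec_sup_span (J : Ideal Poly) (y : Poly) :
    idealVec b (J ⊔ Ideal.span {y}) =
      LinearMap.range (LinearMap.lsmul Poly (Fin b → Poly) y) ⊔ idealVec b J := by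
  ext v
  rw [mem_idealVec, Submodule.mem_sup]
  constructor
  · intro h
    have h' : ∀ p, ∃ a c, a ∈ J ∧ a + y * c = v p := fun p => by
      obtain ⟨a, ha, z, hz, e⟩ := Submodule.mem_sup.1 (h p)
      obtain ⟨c, rfl⟩ := Ideal.mem_span_singleton'.1 hz
      exact ⟨a, c, ha, by rw [← e, mul_comm]⟩
    choose a c ha hac using h'
    exact ⟨_, ⟨c, rfl⟩, a, mem_idealVec.2 ha, funext fun p => by simp [← hac p, add_comm]⟩
  · rintro ⟨_, ⟨c, rfl⟩, a, ha, rfl⟩ p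
    refine Submodule.mem_sup.2 ⟨a p, mem_idealVec.1 ha p, y * c p,
      Ideal.mul_mem_right _ _ (Ideal.mem_span_singleton_self y), ?_⟩
    simp [add_comm]

theorem finrank_map_add_finrank_inf_ker {E E' : Type*} [AddCommGroup E] [Module K E]
    [AddCommGroup E'] [Module K E'] (f : E →ₗ[K] E') (S : Submodule K E) [FiniteDimensional K S] :
    Module.finrank K (S.map f) + Module.finrank K (S ⊓ LinearMap.ker f : Submodule K E) =
      Module.finrank K S := by
  have h := LinearMap.finrank_range_add_finrank_ker (f.domRestrict S)
  rw [← h, LinearMap.range_domRestrict]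
  have e : S ⊓ LinearMap.ker f = (LinearMap.ker (f.domRestrict S)).map S.subtype := by
    ext v
    simp [and_comm]
  rw [e, Submodule.finrank_map_subtype_eq]

theorem finrank_map_sup_add {E E' : Type*} [AddCommGroup E] [Module K E]
    [AddCommGroup E'] [Module K E'] (f : E →ₗ[K] E') (S : Submodule K E) (T : Submodule K E')
    [FiniteDimensional K S] [FiniteDimensional K T] :
    Module.finrank K (S.map f ⊔ T : Submodule K E') +
      Module.finrank K (S ⊓ T.comap f : Submodule K E) =
      Module.finrank K S + Module.finrank K T := by
  have h1 := Submodule.finrank_sup_add_finrank_inf_eq (S.map f) T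
  have h2 := finrank_map_add_finrank_inf_ker f S
  have : FiniteDimensional K (S ⊓ T.comap f : Submodule K E) :=
    Submodule.finiteDimensional_of_le inf_le_left
  have h3 := finrank_map_add_finrank_inf_ker f (S ⊓ T.comap f)
  have e1 : (S ⊓ T.comap f).map f = S.map f ⊓ T := by
    ext v
    constructor
    · rintro ⟨w, ⟨h1, h2⟩, rfl⟩
      exact ⟨⟨w, h1, rfl⟩, h2⟩
    · rintro ⟨⟨w, h1, rfl⟩, h2⟩
      exact ⟨w, ⟨h1, h2⟩, rfl⟩
  have e2 : S ⊓ T.comap f ⊓ LinearMap.ker f = S ⊓ LinearMap.ker f := by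
    ext v
    simp only [Submodule.mem_inf, Submodule.mem_comap, LinearMap.mem_ker]
    exact ⟨fun h => ⟨h.1.1, h.2⟩, fun h => ⟨⟨h.1, by rw [h.2]; exact T.zero_mem⟩, h.2⟩⟩
  rw [e1, e2] at h3
  omega

/-- `f` maps degree `m` to degree `m'` and commutes with taking components. -/
def Intertwines (deg : Fin b → ℤ) (deg' : Fin b' → ℤ) (m m' : ℤ)
    (f : (Fin b → MvPolynomial (Fin (n + 1)) K) →ₗ[MvPolynomial (Fin (n + 1)) K]
      (Fin b' → MvPolynomial (Fin (n + 1)) K)) : Prop :=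
  ∀ v, vecComponent deg' m' (f v) = f (vecComponent deg m v)

theorem Intertwines.map_mem {m m' : ℤ} {f : (Fin b → Poly) →ₗ[Poly] (Fin b' → Poly)}
    (hf : Intertwines deg deg' m m' f) {v : Fin b → Poly} (hv : v ∈ gradedPart deg m) :
    f v ∈ gradedPart deg' m' := by
  rw [← vecComponent_of_mem hv, ← hf]
  exact vecComponent_mem _ _

theorem intertwines_lsmul {y : Poly} (hy : IsHomogeneousOfDegree y 1) (m : ℤ) :
    Intertwines deg deg (m - 1) m (LinearMap.lsmul Poly (Fin b → Poly) y) := fun v =>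
  vecComponent_smul hy m v

/-- Intersecting with a graded piece does not distribute over sums in general. It does here because
taking components preserves each summand. -/
theorem part_range_sup {m m' : ℤ} {f : (Fin b → Poly) →ₗ[Poly] (Fin b' → Poly)}
    (hf : Intertwines deg deg' m m' f) {N : Submodule Poly (Fin b' → Poly)}
    (hN : IsGraded deg' N) :
    part deg' (LinearMap.range f ⊔ N) m' =
      (gradedPart deg m).map (f.restrictScalars K) ⊔ part deg' N m' := by
  apply le_antisymm
  · rintro v ⟨hv, hv'⟩
    obtain ⟨_, ⟨w, rfl⟩, a, ha, e⟩ := Submodule.mem_sup.1 hv'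
    rw [← vecComponent_of_mem hv, ← e, vecComponent_add, hf]
    exact Submodule.add_mem_sup ⟨_, vecComponent_mem _ _, rfl⟩ ⟨vecComponent_mem _ _, hN _ ha _⟩
  · refine sup_le ?_ (part_mono le_sup_right _)
    rintro _ ⟨w, hw, rfl⟩
    exact ⟨hf.map_mem hw, Submodule.mem_sup_left ⟨w, rfl⟩⟩

/-- Rank-nullity for the map into the quotient by `N`. It is applied both to the differentials and
to multiplication by a linear form, and every dimension count on homology rests on it. -/
theorem finrank_part_range_sup {m m' : ℤ} {f : (Fin b → Poly) →ₗ[Poly] (Fin b' → Poly)}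
    (hf : Intertwines deg deg' m m' f) {N : Submodule Poly (Fin b' → Poly)}
    (hN : IsGraded deg' N) :
    Module.finrank K (part deg' (LinearMap.range f ⊔ N) m') +
      Module.finrank K (part deg (N.comap f) m) =
      Module.finrank K (gradedPart (K := K) (n := n) deg m) +
        Module.finrank K (part deg' N m') := by
  have e : part deg (N.comap f) m =
      gradedPart deg m ⊓ (part deg' N m').comap (f.restrictScalars K) := by
    ext v
    exact ⟨fun h => ⟨h.1, hf.map_mem h.1, h.2⟩, fun h => ⟨h.1, h.2.2⟩⟩
  rw [part_range_sup hf hN, ← finrank_map_sup_add (f.restrictScalars K), e]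

end GradedParts

/-! ### Regular sequences of linear forms -/

section LinearForms

variable {K : Type*} [Field K] {n : ℕ}

local notation "Poly" => MvPolynomial (Fin (n + 1)) K

theorem exists_linearEquiv_single_eq {a : Fin (n + 1) → K} (ha : a ≠ 0) :
    ∃ e : (Fin (n + 1) → K) ≃ₗ[K] (Fin (n + 1) → K), e (Pi.single 0 1) = a := by
  classical
  have hs : LinearIndepOn K id ({a} : Set (Fin (n + 1) → K)) := LinearIndepOn.singleton ha
  let B := Module.Basis.extend hs
  have hmem : a ∈ hs.extend (Set.subset_univ _) := hs.subset_extend _ rfl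
  let B1 := B.reindex (B.indexEquiv (Pi.basisFun K (Fin (n + 1))))
  let B2 := B1.reindex (Equiv.swap (B.indexEquiv (Pi.basisFun K (Fin (n + 1))) ⟨a, hmem⟩) 0)
  refine ⟨(Pi.basisFun K (Fin (n + 1))).equiv B2 (Equiv.refl _), ?_⟩
  rw [← Pi.basisFun_apply, Module.Basis.equiv_apply]
  simp [B2, B1, B]

/-- The linear form with coefficient vector `a`. -/
noncomputable def linearForm : (Fin (n + 1) → K) →ₗ[K] MvPolynomial (Fin (n + 1)) K :=
  Fintype.linearCombination K X

theorem linearForm_single (j : Fin (n + 1)) : linearForm (K := K) (Pi.single j 1) = X j := by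
  simp [linearForm, Fintype.linearCombination_apply_single]

theorem isHomogeneousOfDegree_linearForm (a : Fin (n + 1) → K) :
    IsHomogeneousOfDegree (linearForm a) 1 := by
  rw [linearForm, Fintype.linearCombination_apply]
  refine Submodule.sum_mem (weightedHomogeneousSubmodule K (fun _ : Fin (n + 1) => (1 : ℤ)) 1)
    fun i _ => Submodule.smul_mem _ _ ?_
  exact isWeightedHomogeneous_X K _ i

theorem exists_linearForm_eq {f : Poly} (hf : f.IsHomogeneous 1) : ∃ a, linearForm a = f := by
  have h : f ∈ homogeneousSubmodule (Fin (n + 1)) K 1 := hf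
  rw [homogeneousSubmodule_one_eq_span_X, ← Fintype.range_linearCombination] at h
  exact h

/-- The linear change of coordinates given by `e`. -/
noncomputable def linearSubst (e : (Fin (n + 1) → K) →ₗ[K] (Fin (n + 1) → K)) :
    MvPolynomial (Fin (n + 1)) K →ₐ[K] MvPolynomial (Fin (n + 1)) K :=
  aeval fun j => linearForm (e (Pi.single j 1))

theorem linearSubst_linearForm (e : (Fin (n + 1) → K) →ₗ[K] (Fin (n + 1) → K))
    (a : Fin (n + 1) → K) : linearSubst e (linearForm a) = linearForm (e a) := by
  have : (linearSubst e).toLinearMap ∘ₗ linearForm = linearForm ∘ₗ e := by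
    refine (Pi.basisFun K (Fin (n + 1))).ext fun j => ?_
    simp [linearForm_single, linearSubst]
  exact LinearMap.congr_fun this a

theorem linearSubst_comp {e e' : (Fin (n + 1) → K) →ₗ[K] (Fin (n + 1) → K)}
    (h : e ∘ₗ e' = LinearMap.id) : (linearSubst e).comp (linearSubst e') = AlgHom.id K _ := by
  refine MvPolynomial.algHom_ext fun j => ?_
  have h' : linearSubst e' (X j : Poly) = linearForm (e' (Pi.single j 1)) := by
    simp [linearSubst]
  rw [AlgHom.comp_apply, h', linearSubst_linearForm,
    show e (e' (Pi.single j 1)) = Pi.single j 1 from LinearMap.congr_fun h _]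
  simp [linearForm_single]

/-- An invertible linear change of coordinates. -/
noncomputable def linearSubstEquiv (e : (Fin (n + 1) → K) ≃ₗ[K] (Fin (n + 1) → K)) :
    MvPolynomial (Fin (n + 1)) K ≃ₐ[K] MvPolynomial (Fin (n + 1)) K :=
  AlgEquiv.ofAlgHom (linearSubst e.toLinearMap) (linearSubst e.symm.toLinearMap)
    (linearSubst_comp (by ext; simp)) (linearSubst_comp (by ext; simp))

theorem linearSubstEquiv_X (e : (Fin (n + 1) → K) ≃ₗ[K] (Fin (n + 1) → K)) (j : Fin (n + 1)) :
    linearSubstEquiv e (X j) = linearForm (e (Pi.single j 1)) := by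
  simp [linearSubstEquiv, linearSubst]

theorem constantCoeff_linearSubstEquiv (e : (Fin (n + 1) → K) ≃ₗ[K] (Fin (n + 1) → K))
    (f : Poly) : constantCoeff (linearSubstEquiv e f) = constantCoeff f := by
  have : (constantCoeff (R := K) (σ := Fin (n + 1))).comp
      (linearSubstEquiv e).toAlgHom.toRingHom = constantCoeff := by
    refine MvPolynomial.ringHom_ext (fun r => ?_) fun j => ?_
    · simp [linearSubstEquiv, linearSubst]
    · have := linearSubstEquiv_X e j
      simpa [this] using
        constantCoeff_eq_zero (isHomogeneousOfDegree_linearForm _) one_ne_zero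
  exact RingHom.congr_fun this f

/-- The ideal generated by the first `k` terms of a sequence. -/
noncomputable def initialIdeal {R : Type*} [CommRing R] (y : ℕ → R) : ℕ → Ideal R
  | 0 => ⊥
  | k + 1 => initialIdeal y k ⊔ Ideal.span {y k}

theorem initialIdeal_eq_span {R : Type*} [CommRing R] (y : ℕ → R) (k : ℕ) :
    initialIdeal y k = Ideal.span (y '' Set.Iio k) := by
  induction k with
  | zero => simp [initialIdeal]
  | succ k ih =>
    rw [initialIdeal, ih, ← Ideal.span_union, ← Set.image_singleton, ← Set.image_union]
    congr 2
    ext j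
    simp [Order.lt_add_one_iff, le_iff_lt_or_eq]

/-- Membership in an ideal generated by variables is tested monomial by monomial, and multiplying by
a variable outside `s` leaves the exponents in `s` unchanged. -/
theorem mem_span_X_of_X_mul_mem {s : Set (Fin (n + 1))} {k : Fin (n + 1)} (hk : k ∉ s) {f : Poly}
    (hf : X k * f ∈ Ideal.span (X '' s : Set Poly)) : f ∈ Ideal.span (X '' s : Set Poly) := by
  classical
  rw [mem_ideal_span_X_image] at hf ⊢
  intro m hm
  obtain ⟨i, hi, h⟩ := hf (Finsupp.single k 1 + m) (by
    rw [mem_support_iff, coeff_X_mul]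
    exact mem_support_iff.1 hm)
  refine ⟨i, hi, ?_⟩
  rw [Finsupp.add_apply, Finsupp.single_eq_of_ne (by rintro rfl; exact hk hi), zero_add] at h
  exact h

/-- The linear forms in `y` generate the irrelevant ideal and each is regular modulo the previous
ones. -/
structure IsLinearSystem (y : ℕ → MvPolynomial (Fin (n + 1)) K) : Prop where
  homogeneous : ∀ k, IsHomogeneousOfDegree (y k) 1
  regular : ∀ k, k ≤ n → ∀ f, y k * f ∈ initialIdeal y k → f ∈ initialIdeal y k
  irrelevant : ∀ f, f ∈ initialIdeal y (n + 1) ↔ constantCoeff f = 0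

theorem IsLinearSystem.isGradedIdeal {y : ℕ → Poly} (hy : IsLinearSystem y) (k : ℕ) :
    IsGradedIdeal (initialIdeal y k) := by
  induction k with
  | zero => exact IsGradedIdeal.bot
  | succ k ih => exact ih.sup (IsGradedIdeal.span_singleton (hy.homogeneous k))

/-- A linear automorphism sending the first variable to `f` transports the regularity of the
variables to their images. -/
theorem exists_isLinearSystem {f : Poly} (hf : f.IsHomogeneous 1) (hf0 : f ≠ 0) :
    ∃ y, IsLinearSystem y ∧ y 0 = f := by
  obtain ⟨a, rfl⟩ := exists_linearForm_eq hf
  obtain ⟨e, rfl⟩ := exists_linearEquiv_single_eq (a := a) (by rintro rfl; simp at hf0)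
  set φ := linearSubstEquiv e
  let y : ℕ → Poly := fun k => if h : k < n + 1 then φ (X ⟨k, h⟩) else 0
  have hy : ∀ k (h : k < n + 1), y k = φ (X ⟨k, h⟩) := fun k h => dif_pos h
  have hJ : ∀ k, k ≤ n + 1 → ∀ f : Poly, φ f ∈ initialIdeal y k ↔
      f ∈ Ideal.span (X '' {i : Fin (n + 1) | (i : ℕ) < k} : Set Poly) := by
    intro k hk f
    have : initialIdeal y k =
        (Ideal.span (X '' {i : Fin (n + 1) | (i : ℕ) < k} : Set Poly)).map φ := by
      rw [initialIdeal_eq_span, Ideal.map_span, Set.image_image]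
      congr 1
      ext z
      constructor
      · rintro ⟨j, hj, rfl⟩
        have hj' : j < k := hj
        exact ⟨⟨j, by omega⟩, hj', (hy j (by omega)).symm⟩
      · rintro ⟨j, hj, rfl⟩
        exact ⟨j, hj, hy j j.2⟩
    rw [this, Ideal.mem_map_of_equiv]
    exact ⟨fun ⟨g, hg, h⟩ => φ.injective h ▸ hg, fun h => ⟨f, h, rfl⟩⟩
  refine ⟨y, ⟨fun k => ?_, fun k hk f h => ?_, fun f => ?_⟩, ?_⟩
  · by_cases h : k < n + 1
    · rw [hy k h, linearSubstEquiv_X]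
      exact isHomogeneousOfDegree_linearForm _
    · simp only [y, dif_neg h]
      exact isWeightedHomogeneous_zero _ _ _
  · obtain ⟨f, rfl⟩ := φ.surjective f
    rw [hy k (by omega), ← map_mul, hJ k (by omega)] at h
    rw [hJ k (by omega)]
    exact mem_span_X_of_X_mul_mem (by simp) h
  · obtain ⟨f, rfl⟩ := φ.surjective f
    rw [hJ _ le_rfl, constantCoeff_linearSubstEquiv, mem_ideal_span_X_image]
    constructor
    · intro h
      by_contra h0
      obtain ⟨i, _, hi⟩ := h 0 (mem_support_iff.2 h0)
      exact hi rfl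
    · intro h m hm
      by_contra! h0
      have : m = 0 := Finsupp.ext fun i => h0 i i.2
      subst this
      exact mem_support_iff.1 hm h
  · rw [hy 0 (by omega)]
    exact linearSubstEquiv_X e 0

/-- An upper bound suffices: it is only compared with Hilbert function values that attain it. -/
theorem finrank_homogeneousSubmodule_le (j : ℕ) :
    Module.finrank K (homogeneousSubmodule (Fin (n + 1)) K j) ≤ (n + j).choose n := by
  classical
  have h : homogeneousSubmodule (Fin (n + 1)) K j = Submodule.span K
      (((Finset.univ.finsuppAntidiag j).image fun e => monomial e (1 : K) : Finset Poly) :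
        Set Poly) := by
    apply le_antisymm
    · intro f hf
      rw [f.as_sum]
      refine Submodule.sum_mem _ fun e he => ?_
      rw [← mul_one (coeff e f), ← smul_eq_mul, ← smul_monomial]
      refine Submodule.smul_mem _ _ (Submodule.subset_span ?_)
      simp only [Finset.coe_image, Set.mem_image, Finset.mem_coe]
      refine ⟨e, ?_, rfl⟩
      have := hf (mem_support_iff.1 he)
      rw [Finset.mem_finsuppAntidiag]
      exact ⟨by simpa [Finsupp.weight_apply, Finsupp.sum_fintype] using this,
        Finset.subset_univ _⟩
    · rw [Submodule.span_le]
      intro f hf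
      simp only [Finset.coe_image, Set.mem_image, Finset.mem_coe] at hf
      obtain ⟨e, he, rfl⟩ := hf
      refine isHomogeneous_monomial _ ?_
      rw [Finset.mem_finsuppAntidiag] at he
      simpa [Finsupp.degree_eq_sum] using he.1
  rw [h]
  refine (finrank_span_finset_le_card _).trans (Finset.card_image_le.trans ?_)
  rw [Finset.card_finsuppAntidiag_nat_eq_choose]
  simp only [Finset.card_univ, Fintype.card_fin]
  rw [show n + 1 + j - 1 = n + j by omega, ← Nat.choose_symm_add]

end LinearForms

/-! ### Homology of the resolution modulo linear forms -/

section Homology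

variable {K : Type*} [Field K] {n : ℕ}

local notation "Poly" => MvPolynomial (Fin (n + 1)) K

namespace GradedFreeResolution

variable {I : Ideal (MvPolynomial (Fin (n + 1)) K)} (F : GradedFreeResolution I)

/-- The cycles modulo `J` in homological degree `i`. -/
noncomputable def cyclesMod (J : Ideal (MvPolynomial (Fin (n + 1)) K)) :
    (i : ℕ) → Submodule (MvPolynomial (Fin (n + 1)) K)
      (Fin (F.rank i) → MvPolynomial (Fin (n + 1)) K)
  | 0 => ⊤
  | i + 1 => (idealVec (F.rank i) J).comap (F.d i).mulVecLin

/-- The boundaries modulo `J` in homological degree `i`. -/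
noncomputable def boundariesMod (J : Ideal (MvPolynomial (Fin (n + 1)) K)) (i : ℕ) :
    Submodule (MvPolynomial (Fin (n + 1)) K) (Fin (F.rank i) → MvPolynomial (Fin (n + 1)) K) :=
  LinearMap.range (F.d i).mulVecLin ⊔ idealVec (F.rank i) J

/-- The dimension of the degree `m` part of `H_i(F / J F)`. -/
noncomputable def homologyDim (J : Ideal (MvPolynomial (Fin (n + 1)) K)) (i : ℕ) (m : ℤ) : ℤ :=
  Module.finrank K (part (F.degree i) (F.cyclesMod J i) m) -
    Module.finrank K (part (F.degree i) (F.boundariesMod J i) m)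

/-- The elements that are multiplied by `y` into the boundaries modulo `J`. -/
noncomputable def boundariesColon (J : Ideal (MvPolynomial (Fin (n + 1)) K))
    (y : MvPolynomial (Fin (n + 1)) K) (i : ℕ) :
    Submodule (MvPolynomial (Fin (n + 1)) K) (Fin (F.rank i) → MvPolynomial (Fin (n + 1)) K) :=
  (F.boundariesMod J i).comap
    (LinearMap.lsmul _ (Fin (F.rank i) → MvPolynomial (Fin (n + 1)) K) y)

/-- The rank of multiplication by the linear form `y` from degree `m - 1` to degree `m` of
`H_i(F / J F)`. -/
noncomputable def mulRank (J : Ideal (MvPolynomial (Fin (n + 1)) K))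
    (y : MvPolynomial (Fin (n + 1)) K) (i : ℕ) (m : ℤ) : ℤ :=
  Module.finrank K (part (F.degree i) (F.cyclesMod J i) (m - 1)) -
    Module.finrank K (part (F.degree i) (F.boundariesColon J y i) (m - 1))

theorem intertwines_d (i : ℕ) (m : ℤ) :
    Intertwines (F.degree (i + 1)) (F.degree i) m m (F.d i).mulVecLin := fun v =>
  (vecComponent_mulVec _ _ _ (F.d_homogeneous i) m v).symm

theorem d_comp_d (i : ℕ) (v : Fin (F.rank (i + 2)) → Poly) :
    (F.d i).mulVecLin ((F.d (i + 1)).mulVecLin v) = 0 := by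
  have : (F.d (i + 1)).mulVecLin v ∈ LinearMap.ker (F.d i).mulVecLin := by
    rw [← F.exact_succ]
    exact ⟨v, rfl⟩
  exact this

theorem mulVecLin_mem_idealVec {b b' : ℕ} (M : Matrix (Fin b) (Fin b') Poly) {J : Ideal Poly}
    {v : Fin b' → Poly} (hv : v ∈ idealVec b' J) : M.mulVecLin v ∈ idealVec b J := by
  rw [mem_idealVec] at hv ⊢
  intro p
  rw [Matrix.mulVecLin_apply, Matrix.mulVec, dotProduct]
  exact Submodule.sum_mem _ fun q _ => J.mul_mem_left _ (hv q)

theorem boundariesMod_le_cyclesMod (J : Ideal Poly) (i : ℕ) :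
    F.boundariesMod J i ≤ F.cyclesMod J i := by
  cases i with
  | zero => exact le_top
  | succ i =>
    refine sup_le ?_ fun v hv => mulVecLin_mem_idealVec _ hv
    rintro _ ⟨v, rfl⟩
    change (F.d i).mulVecLin ((F.d (i + 1)).mulVecLin v) ∈ idealVec (F.rank i) J
    rw [F.d_comp_d]
    exact Submodule.zero_mem _

theorem isGraded_range_d (i : ℕ) :
    IsGraded (F.degree i) (LinearMap.range (F.d i).mulVecLin) := by
  rintro _ ⟨v, rfl⟩ m
  rw [F.intertwines_d]
  exact ⟨_, rfl⟩

theorem isGraded_boundariesMod {J : Ideal Poly} (hJ : IsGradedIdeal J) (i : ℕ) :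
    IsGraded (F.degree i) (F.boundariesMod J i) :=
  (F.isGraded_range_d i).sup (IsGraded.idealVec hJ)

theorem boundariesMod_sup_span (J : Ideal Poly) (y : Poly) (i : ℕ) :
    F.boundariesMod (J ⊔ Ideal.span {y}) i =
      LinearMap.range (LinearMap.lsmul Poly (Fin (F.rank i) → Poly) y) ⊔ F.boundariesMod J i := by
  rw [boundariesMod, idealVec_sup_span, boundariesMod, sup_left_comm]

theorem comap_lsmul_idealVec {b : ℕ} {J : Ideal Poly} {y : Poly}
    (hreg : ∀ f, y * f ∈ J → f ∈ J) :
    (idealVec b J).comap (LinearMap.lsmul Poly (Fin b → Poly) y) = idealVec b J := by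
  ext v
  rw [Submodule.mem_comap, mem_idealVec, mem_idealVec]
  exact ⟨fun h p => hreg _ (h p), fun h p => J.mul_mem_left _ (h p)⟩

/-- If `y • a` is a boundary modulo `J`, then `y` times the differential of `a` has entries in `J`,
and `y` cancels by regularity. Thus the colon modulo boundaries is exactly the kernel of `y` on
homology, which justifies the formula for `mulRank`. -/
theorem boundariesColon_le_cyclesMod {J : Ideal Poly} {y : Poly}
    (hreg : ∀ f, y * f ∈ J → f ∈ J) (i : ℕ) : F.boundariesColon J y i ≤ F.cyclesMod J i := by
  intro a ha
  have h : y • a ∈ F.cyclesMod J i := F.boundariesMod_le_cyclesMod J i ha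
  cases i with
  | zero => trivial
  | succ i =>
    change (F.d i).mulVecLin (y • a) ∈ idealVec _ J at h
    rw [map_smul] at h
    change (F.d i).mulVecLin a ∈ idealVec _ J
    rw [← comap_lsmul_idealVec hreg]
    exact h

theorem boundariesMod_le_boundariesColon (J : Ideal Poly) (y : Poly) (i : ℕ) :
    F.boundariesMod J i ≤ F.boundariesColon J y i := fun _ hv =>
  Submodule.smul_mem _ y hv

theorem homologyDim_nonneg (J : Ideal Poly) (i : ℕ) (m : ℤ) : 0 ≤ F.homologyDim J i m := by
  have := Submodule.finrank_mono
    (part_mono (deg := F.degree i) (F.boundariesMod_le_cyclesMod J i) m)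
  rw [homologyDim]
  omega

theorem mulRank_nonneg {J : Ideal Poly} {y : Poly} (hreg : ∀ f, y * f ∈ J → f ∈ J)
    (i : ℕ) (m : ℤ) : 0 ≤ F.mulRank J y i m := by
  have := Submodule.finrank_mono
    (part_mono (deg := F.degree i) (F.boundariesColon_le_cyclesMod hreg i) (m - 1))
  rw [mulRank]
  omega

theorem mulRank_le_source (J : Ideal Poly) (y : Poly) (i : ℕ) (m : ℤ) :
    F.mulRank J y i m ≤ F.homologyDim J i (m - 1) := by
  have := Submodule.finrank_mono
    (part_mono (deg := F.degree i) (F.boundariesMod_le_boundariesColon J y i) (m - 1))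
  rw [mulRank, homologyDim]
  omega

theorem mulRank_le_target {J : Ideal Poly} {y : Poly} (hy : IsHomogeneousOfDegree y 1)
    (hreg : ∀ f, y * f ∈ J → f ∈ J) (i : ℕ) (m : ℤ) :
    F.mulRank J y i m ≤ F.homologyDim J i m := by
  have h := finrank_map_sup_add
    ((LinearMap.lsmul Poly (Fin (F.rank i) → Poly) y).restrictScalars K)
    (part (F.degree i) (F.cyclesMod J i) (m - 1)) (part (F.degree i) (F.boundariesMod J i) m)
  have hmap := fun v => (intertwines_lsmul (deg := F.degree i) hy m).map_mem (v := v)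
  have e : part (F.degree i) (F.cyclesMod J i) (m - 1) ⊓
      (part (F.degree i) (F.boundariesMod J i) m).comap
        ((LinearMap.lsmul Poly (Fin (F.rank i) → Poly) y).restrictScalars K) =
      part (F.degree i) (F.boundariesColon J y i) (m - 1) := by
    ext v
    exact ⟨fun h => ⟨h.1.1, h.2.2⟩, fun h =>
      ⟨⟨h.1, F.boundariesColon_le_cyclesMod hreg i h.2⟩, hmap v h.1, h.2⟩⟩
  rw [e] at h
  have hle : (part (F.degree i) (F.cyclesMod J i) (m - 1)).map
      ((LinearMap.lsmul Poly (Fin (F.rank i) → Poly) y).restrictScalars K) ⊔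
      part (F.degree i) (F.boundariesMod J i) m ≤ part (F.degree i) (F.cyclesMod J i) m := by
    refine sup_le ?_ (part_mono (F.boundariesMod_le_cyclesMod J i) m)
    rintro _ ⟨v, hv, rfl⟩
    exact ⟨hmap v hv.1, Submodule.smul_mem _ y hv.2⟩
  have := Submodule.finrank_mono hle
  rw [mulRank, homologyDim]
  omega

theorem finrank_boundariesMod_sup_span {J : Ideal Poly} (hJ : IsGradedIdeal J) {y : Poly}
    (hy : IsHomogeneousOfDegree y 1) (i : ℕ) (m : ℤ) :
    Module.finrank K (part (F.degree i) (F.boundariesMod (J ⊔ Ideal.span {y}) i) m) +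
      Module.finrank K (part (F.degree i) (F.boundariesColon J y i) (m - 1)) =
      Module.finrank K (gradedPart (K := K) (n := n) (F.degree i) (m - 1)) +
        Module.finrank K (part (F.degree i) (F.boundariesMod J i) m) := by
  rw [boundariesMod_sup_span]
  exact finrank_part_range_sup (intertwines_lsmul hy m) (F.isGraded_boundariesMod hJ i)

theorem finrank_boundariesMod {J : Ideal Poly} (hJ : IsGradedIdeal J) (i : ℕ) (m : ℤ) :
    Module.finrank K (part (F.degree i) (F.boundariesMod J i) m) +
      Module.finrank K (part (F.degree (i + 1)) (F.cyclesMod J (i + 1)) m) =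
      Module.finrank K (gradedPart (K := K) (n := n) (F.degree (i + 1)) m) +
        Module.finrank K (part (F.degree i) (idealVec (F.rank i) J) m) :=
  finrank_part_range_sup (F.intertwines_d i m) (IsGraded.idealVec hJ)

theorem finrank_idealVec_sup_span {b : ℕ} {deg : Fin b → ℤ} {J : Ideal Poly}
    (hJ : IsGradedIdeal J) {y : Poly} (hy : IsHomogeneousOfDegree y 1)
    (hreg : ∀ f, y * f ∈ J → f ∈ J) (m : ℤ) :
    Module.finrank K (part deg (idealVec b (J ⊔ Ideal.span {y})) m) +
      Module.finrank K (part deg (idealVec b J) (m - 1)) =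
      Module.finrank K (gradedPart (K := K) (n := n) deg (m - 1)) +
        Module.finrank K (part deg (idealVec b J) m) := by
  have := finrank_part_range_sup (intertwines_lsmul (deg := deg) hy m)
    (IsGraded.idealVec (deg := deg) hJ)
  rwa [comap_lsmul_idealVec hreg, ← idealVec_sup_span] at this

theorem homologyDim_sup_span_zero {J : Ideal Poly} (hJ : IsGradedIdeal J) {y : Poly}
    (hy : IsHomogeneousOfDegree y 1) (m : ℤ) :
    F.homologyDim (J ⊔ Ideal.span {y}) 0 m + F.mulRank J y 0 m = F.homologyDim J 0 m := by
  have h := F.finrank_boundariesMod_sup_span hJ hy 0 m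
  have h' : ∀ (J : Ideal Poly) (m : ℤ),
      Module.finrank K (part (F.degree 0) (F.cyclesMod J 0) m) =
        Module.finrank K (gradedPart (K := K) (n := n) (F.degree 0) m) := fun J m => by
    rw [cyclesMod, part_top]
  rw [homologyDim, homologyDim, mulRank, h', h', h']
  omega

/-- This is the long exact sequence in numbers: the new homology is the cokernel of `y` on `H_(i+1)`
plus the kernel of `y` on `H_i` in degree `m - 1`. Instead of a connecting map, the rank-nullity
identities for boundaries, cycles and ideal vectors are combined linearly. -/
theorem homologyDim_sup_span_succ {J : Ideal Poly} (hJ : IsGradedIdeal J) {y : Poly}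
    (hy : IsHomogeneousOfDegree y 1) (hreg : ∀ f, y * f ∈ J → f ∈ J) (i : ℕ) (m : ℤ) :
    F.homologyDim (J ⊔ Ideal.span {y}) (i + 1) m + F.mulRank J y (i + 1) m + F.mulRank J y i m =
      F.homologyDim J (i + 1) m + F.homologyDim J i (m - 1) := by
  have hJ' := hJ.sup (IsGradedIdeal.span_singleton hy)
  have h1 := F.finrank_boundariesMod_sup_span hJ hy i m
  have h2 := F.finrank_boundariesMod_sup_span hJ hy (i + 1) m
  have h3 := F.finrank_boundariesMod hJ i m
  have h4 := F.finrank_boundariesMod hJ i (m - 1)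
  have h5 := F.finrank_boundariesMod hJ' i m
  have h6 := finrank_idealVec_sup_span (deg := F.degree i) hJ hy hreg m
  simp only [homologyDim, mulRank]
  omega

theorem homologyDim_bot_succ (i : ℕ) (m : ℤ) : F.homologyDim ⊥ (i + 1) m = 0 := by
  have : F.cyclesMod ⊥ (i + 1) = F.boundariesMod ⊥ (i + 1) := by
    rw [cyclesMod, boundariesMod, idealVec_bot, idealVec_bot, sup_bot_eq, F.exact_succ]
    rfl
  rw [homologyDim, this, sub_self]

/-! ### Modulo the irrelevant ideal the homology is Tor -/

section Tor

variable (J : Ideal (MvPolynomial (Fin (n + 1)) K))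

/-- Reduction of the degree `m` part of `F_i` modulo the irrelevant ideal. -/
noncomputable def reduce (i : ℕ) (m : ℤ) : (Fin (F.rank i) → MvPolynomial (Fin (n + 1)) K) →ₗ[K]
    ({p : Fin (F.rank i) // F.degree i p = m} → K) :=
  LinearMap.pi fun p => (aeval (R := K) (0 : Fin (n + 1) → K)).toLinearMap ∘ₗ
    LinearMap.proj p.1

theorem reduce_apply (i : ℕ) (m : ℤ) (v : Fin (F.rank i) → Poly) (p) :
    F.reduce i m v p = constantCoeff (v p.1) := by
  simp [reduce]

theorem exists_reduce_eq (i : ℕ) (m : ℤ) (c : {p : Fin (F.rank i) // F.degree i p = m} → K) :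
    ∃ v ∈ gradedPart (F.degree i) m, F.reduce i m v = c := by
  classical
  refine ⟨fun p => if h : F.degree i p = m then C (c ⟨p, h⟩) else 0, fun p => ?_, ?_⟩
  · dsimp only
    split_ifs with h
    · rw [h, sub_self]
      exact isWeightedHomogeneous_C _ _
    · exact isWeightedHomogeneous_zero _ _ _
  · funext p
    rw [reduce_apply, dif_pos p.2]
    simp

theorem reduce_d (i : ℕ) (m : ℤ) {v : Fin (F.rank (i + 1)) → Poly}
    (hv : v ∈ gradedPart (F.degree (i + 1)) m) :
    F.reduce i m ((F.d i).mulVecLin v) = (F.dbar i m).mulVecLin (F.reduce (i + 1) m v) := by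
  classical
  funext p
  rw [reduce_apply, Matrix.mulVecLin_apply, Matrix.mulVecLin_apply, Matrix.mulVec, Matrix.mulVec,
    dotProduct, dotProduct, map_sum,
    ← Fintype.sum_subtype_add_sum_subtype fun q => F.degree (i + 1) q = m]
  convert add_zero _ using 2
  · refine Finset.sum_eq_zero fun q _ => ?_
    have := q.2
    rw [map_mul, constantCoeff_eq_zero (hv q) (by omega), mul_zero]
  · simp [reduce_apply, dbar]

variable {J}

theorem mem_idealVec_iff_reduce (hJ : ∀ f, f ∈ J ↔ constantCoeff f = 0) (i : ℕ) (m : ℤ)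
    {v : Fin (F.rank i) → Poly} (hv : v ∈ gradedPart (F.degree i) m) :
    v ∈ idealVec (F.rank i) J ↔ F.reduce i m v = 0 := by
  rw [mem_idealVec, funext_iff]
  constructor
  · intro h p
    rw [reduce_apply]
    exact (hJ _).1 (h _)
  · intro h p
    rw [hJ]
    by_cases hp : F.degree i p = m
    · rw [← F.reduce_apply i m v ⟨p, hp⟩, h]
      rfl
    · exact constantCoeff_eq_zero (hv p) (by omega)

theorem mem_cyclesMod_iff_reduce (hJ : ∀ f, f ∈ J ↔ constantCoeff f = 0) (i : ℕ) (m : ℤ)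
    {v : Fin (F.rank i) → Poly} (hv : v ∈ gradedPart (F.degree i) m) :
    v ∈ F.cyclesMod J i ↔ F.reduce i m v ∈ F.cycles i m := by
  cases i with
  | zero => simp [cyclesMod, cycles]
  | succ i =>
    rw [cyclesMod, Submodule.mem_comap,
      F.mem_idealVec_iff_reduce hJ i m ((F.intertwines_d i m).map_mem hv), F.reduce_d i m hv]
    rfl

theorem mem_boundariesMod_iff_reduce (hJ : ∀ f, f ∈ J ↔ constantCoeff f = 0) (i : ℕ) (m : ℤ)
    {v : Fin (F.rank i) → Poly} (hv : v ∈ gradedPart (F.degree i) m) :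
    v ∈ F.boundariesMod J i ↔ F.reduce i m v ∈ F.boundaries i m := by
  constructor
  · intro h
    obtain ⟨_, ⟨w, rfl⟩, a, ha, e⟩ := Submodule.mem_sup.1 h
    have ha' : F.reduce i m a = 0 := by
      funext p
      rw [reduce_apply]
      exact (hJ _).1 (mem_idealVec.1 ha _)
    have e' : vecComponent (F.degree i) m a + (F.d i).mulVecLin
        (vecComponent (F.degree (i + 1)) m w) = v := by
      rw [← F.intertwines_d, ← vecComponent_add, add_comm a, e, vecComponent_of_mem hv]
    -- At basis elements of degree `m` the component taken is the one of degree zero, which keeps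
    -- the constant term.
    have ha'' : F.reduce i m (vecComponent (F.degree i) m a) = 0 := by
      funext p
      rw [reduce_apply, vecComponent_apply, p.2, sub_self]
      have := congr_fun ha' p
      rw [reduce_apply] at this
      simpa [constantCoeff_eq, coeff_weightedHomogeneousComponent] using this
    rw [← e', map_add, ha'', zero_add, F.reduce_d i m (vecComponent_mem _ _)]
    exact ⟨_, rfl⟩
  · rintro ⟨c, hc⟩
    obtain ⟨w, hw, rfl⟩ := F.exists_reduce_eq (i + 1) m c
    have hdw := (F.intertwines_d i m).map_mem hw
    have h : v - (F.d i).mulVecLin w ∈ idealVec (F.rank i) J := by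
      rw [F.mem_idealVec_iff_reduce hJ i m (Submodule.sub_mem _ hv hdw), map_sub,
        F.reduce_d i m hw, hc, sub_self]
    exact Submodule.mem_sup.2 ⟨_, ⟨w, rfl⟩, _, h, by abel⟩

/-- The last summand does not depend on `N`, so it cancels when boundaries are subtracted from
cycles. -/
theorem finrank_part_of_reduce (i : ℕ) (m : ℤ) {N : Submodule Poly (Fin (F.rank i) → Poly)}
    {S : Submodule K ({p : Fin (F.rank i) // F.degree i p = m} → K)}
    (h : ∀ v ∈ gradedPart (F.degree i) m, v ∈ N ↔ F.reduce i m v ∈ S) :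
    Module.finrank K (part (F.degree i) N m) = Module.finrank K S +
      Module.finrank K (gradedPart (F.degree i) m ⊓ LinearMap.ker (F.reduce i m) :
        Submodule K (Fin (F.rank i) → Poly)) := by
  rw [← finrank_map_add_finrank_inf_ker (F.reduce i m)]
  have e1 : (part (F.degree i) N m).map (F.reduce i m) = S := by
    ext c
    constructor
    · rintro ⟨v, hv, rfl⟩
      exact (h v hv.1).1 hv.2
    · intro hc
      obtain ⟨v, hv, rfl⟩ := F.exists_reduce_eq i m c
      exact ⟨v, ⟨hv, (h v hv).2 hc⟩, rfl⟩
  have e2 : part (F.degree i) N m ⊓ LinearMap.ker (F.reduce i m) =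
      gradedPart (F.degree i) m ⊓ LinearMap.ker (F.reduce i m) := by
    ext v
    refine ⟨fun hv => ⟨hv.1.1, hv.2⟩, fun hv => ⟨⟨hv.1, (h v hv.1).2 ?_⟩, hv.2⟩⟩
    rw [LinearMap.mem_ker.1 hv.2]
    exact S.zero_mem
  rw [e1, e2]

theorem tor_eq_homologyDim (hJ : ∀ f, f ∈ J ↔ constantCoeff f = 0) (i : ℕ) (m : ℤ) :
    (F.tor i m : ℤ) = F.homologyDim J i m := by
  have h1 := F.finrank_part_of_reduce i m fun v hv => F.mem_cyclesMod_iff_reduce hJ i m hv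
  have h2 := F.finrank_part_of_reduce i m fun v hv => F.mem_boundariesMod_iff_reduce hJ i m hv
  have hle : F.boundaries i m ≤ F.cycles i m := by
    intro c hc
    obtain ⟨v, hv, rfl⟩ := F.exists_reduce_eq i m c
    rw [← F.mem_boundariesMod_iff_reduce hJ i m hv] at hc
    rw [← F.mem_cyclesMod_iff_reduce hJ i m hv]
    exact F.boundariesMod_le_cyclesMod J i hc
  have h3 := Submodule.finrank_quotient_add_finrank
    ((F.boundaries i m).submoduleOf (F.cycles i m))
  rw [(Submodule.submoduleOfEquivOfLe hle).finrank_eq] at h3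
  rw [homologyDim, h1, h2, tor, ← h3]
  push_cast
  ring

end Tor

end GradedFreeResolution

end Homology

/-! ### Zeroth homology and the Hilbert function -/

section DegreeZero

variable {K : Type*} [Field K] {n : ℕ}

local notation "Poly" => MvPolynomial (Fin (n + 1)) K

/-- The Hilbert function already attains the bound for the polynomial ring, so no dimension is left
for the kernel. -/
theorem eq_zero_of_mem_of_finrank_piece {I : Ideal Poly} {j : ℕ}
    (hj : hilbertFunction I j = (n + j).choose n) {f : Poly} (hf : f.IsHomogeneous j)
    (hfI : f ∈ I) : f = 0 := by
  have : FiniteDimensional K (homogeneousSubmodule (Fin (n + 1)) K j) :=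
    Module.Finite.iff_fg.2 (homogeneousSubmodule_fg _ _ _)
  have h1 := finrank_map_add_finrank_inf_ker (Ideal.Quotient.mkₐ K I).toLinearMap
    (homogeneousSubmodule (Fin (n + 1)) K j)
  have h2 := finrank_homogeneousSubmodule_le (K := K) (n := n) j
  change hilbertFunction I j + _ = _ at h1
  have h3 : Module.finrank K (homogeneousSubmodule (Fin (n + 1)) K j ⊓
      LinearMap.ker (Ideal.Quotient.mkₐ K I).toLinearMap : Submodule K Poly) = 0 := by omega
  have : FiniteDimensional K (homogeneousSubmodule (Fin (n + 1)) K j ⊓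
      LinearMap.ker (Ideal.Quotient.mkₐ K I).toLinearMap : Submodule K Poly) :=
    Submodule.finiteDimensional_of_le inf_le_left
  rw [Submodule.finrank_eq_zero] at h3
  have : f ∈ (⊥ : Submodule K Poly) := by
    rw [← h3]
    exact ⟨hf, Ideal.Quotient.eq_zero_iff_mem.2 hfI⟩
  exact this

theorem mem_piece {I : Ideal Poly} {j : ℕ} {a : Poly ⧸ I} :
    a ∈ piece I j ↔ ∃ f : Poly, IsHomogeneousOfDegree f (j : ℤ) ∧ Ideal.Quotient.mk I f = a := by
  simp only [isHomogeneousOfDegree_natCast]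
  rfl

namespace GradedFreeResolution

variable {I : Ideal (MvPolynomial (Fin (n + 1)) K)} (F : GradedFreeResolution I)

/-- A lift of the augmentation to polynomials. -/
noncomputable def augLift : (Fin (F.rank 0) → MvPolynomial (Fin (n + 1)) K) →ₗ[
    MvPolynomial (Fin (n + 1)) K] MvPolynomial (Fin (n + 1)) K :=
  Fintype.linearCombination (MvPolynomial (Fin (n + 1)) K)
    fun p => (F.aug_homogeneous p).choose

theorem mk_augLift (v : Fin (F.rank 0) → Poly) :
    Ideal.Quotient.mk I (F.augLift v) = Fintype.linearCombination Poly F.aug v := by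
  rw [augLift, Fintype.linearCombination_apply, Fintype.linearCombination_apply, map_sum]
  refine Finset.sum_congr rfl fun p _ => ?_
  refine (map_mul _ _ _).trans ?_
  rw [(F.aug_homogeneous p).choose_spec.2]
  rfl

theorem comp_augLift (m : ℤ) (v : Fin (F.rank 0) → Poly) :
    comp m (F.augLift v) = F.augLift (vecComponent (F.degree 0) m v) := by
  rw [augLift, Fintype.linearCombination_apply, Fintype.linearCombination_apply, map_sum]
  refine Finset.sum_congr rfl fun p _ => ?_
  rw [smul_eq_mul, smul_eq_mul, mul_comm, comp_mul (F.aug_homogeneous p).choose_spec.1,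
    vecComponent_apply, mul_comm]

theorem augLift_homogeneous {m : ℤ} {v : Fin (F.rank 0) → Poly}
    (hv : v ∈ gradedPart (F.degree 0) m) : IsHomogeneousOfDegree (F.augLift v) m := by
  rw [← vecComponent_of_mem hv, ← comp_augLift]
  exact comp_mem _ _

theorem mem_range_d_zero {v : Fin (F.rank 0) → Poly} :
    v ∈ LinearMap.range (F.d 0).mulVecLin ↔ F.augLift v ∈ I := by
  rw [F.exact_zero, LinearMap.mem_ker, ← mk_augLift, Ideal.Quotient.eq_zero_iff_mem]

theorem exists_augLift_sub_mem (f : Poly) : ∃ v, F.augLift v - f ∈ I := by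
  obtain ⟨v, hv⟩ := F.aug_surjective (Ideal.Quotient.mk I f)
  exact ⟨v, by rw [← Ideal.Quotient.eq, mk_augLift, hv]⟩

theorem exists_mem_gradedPart_augLift_sub_mem (hI : IsGradedIdeal I) {m : ℤ} {f : Poly}
    (hf : IsHomogeneousOfDegree f m) :
    ∃ v ∈ gradedPart (F.degree 0) m, F.augLift v - f ∈ I := by
  obtain ⟨v, hv⟩ := F.exists_augLift_sub_mem f
  refine ⟨_, vecComponent_mem m v, ?_⟩
  have := hI _ hv m
  rwa [map_sub, comp_of_mem hf, comp_augLift] at this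

/-- This identifies `H_0(F / J F)` with `R / (I + J)`, with no assumption that `F` is minimal or
that `F_0` has rank one. -/
theorem mem_boundariesMod_zero {J : Ideal Poly} {v : Fin (F.rank 0) → Poly} :
    v ∈ F.boundariesMod J 0 ↔ F.augLift v ∈ I ⊔ J := by
  constructor
  · intro h
    obtain ⟨w, hw, a, ha, rfl⟩ := Submodule.mem_sup.1 h
    rw [map_add]
    refine Submodule.add_mem_sup (F.mem_range_d_zero.1 hw) ?_
    rw [augLift, Fintype.linearCombination_apply]
    exact Submodule.sum_mem _ fun p _ => J.mul_mem_right _ (mem_idealVec.1 ha p)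
  · intro h
    obtain ⟨a, ha, c, hc, e⟩ := Submodule.mem_sup.1 h
    -- A lift `w` of `1` turns the `J`-part `c` into the vector `c • w`, whose entries lie in `J`.
    obtain ⟨w, hw⟩ := F.exists_augLift_sub_mem 1
    refine Submodule.mem_sup.2 ⟨v - c • w, F.mem_range_d_zero.2 ?_, c • w,
      mem_idealVec.2 fun p => J.mul_mem_right _ hc, sub_add_cancel _ _⟩
    have : F.augLift (v - c • w) = a - c * (F.augLift w - 1) := by
      rw [map_sub, map_smul, ← e, smul_eq_mul]
      ring
    rw [this]
    exact I.sub_mem ha (I.mul_mem_left _ hw)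

theorem homologyDim_bot_zero_natCast (hI : IsGradedIdeal I) (j : ℕ) :
    F.homologyDim ⊥ 0 (j : ℤ) = hilbertFunction I j := by
  have h := finrank_map_add_finrank_inf_ker
    ((Ideal.Quotient.mkₐ K I).toLinearMap ∘ₗ F.augLift.restrictScalars K)
    (gradedPart (F.degree 0) (j : ℤ))
  have e1 : (gradedPart (F.degree 0) (j : ℤ)).map
      ((Ideal.Quotient.mkₐ K I).toLinearMap ∘ₗ F.augLift.restrictScalars K) = piece I j := by
    ext a
    rw [mem_piece]
    constructor
    · rintro ⟨v, hv, rfl⟩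
      exact ⟨_, F.augLift_homogeneous hv, rfl⟩
    · rintro ⟨f, hf, rfl⟩
      obtain ⟨v, hv, hvf⟩ := F.exists_mem_gradedPart_augLift_sub_mem hI hf
      exact ⟨v, hv, Ideal.Quotient.eq.2 hvf⟩
  have e2 : gradedPart (F.degree 0) (j : ℤ) ⊓
      LinearMap.ker ((Ideal.Quotient.mkₐ K I).toLinearMap ∘ₗ F.augLift.restrictScalars K) =
      part (F.degree 0) (F.boundariesMod ⊥ 0) j := by
    ext v
    refine and_congr Iff.rfl ?_
    change _ ↔ v ∈ F.boundariesMod ⊥ 0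
    rw [mem_boundariesMod_zero, sup_bot_eq]
    exact Ideal.Quotient.eq_zero_iff_mem
  rw [e1, e2] at h
  rw [homologyDim, cyclesMod, part_top, ← h, hilbertFunction]
  push_cast
  ring

theorem homologyDim_zero_of_neg (J : Ideal Poly) {m : ℤ} (hm : m < 0) :
    F.homologyDim J 0 m = 0 := by
  have : part (F.degree 0) (F.cyclesMod J 0) m ≤ part (F.degree 0) (F.boundariesMod J 0) m := by
    refine fun v hv => ⟨hv.1, F.mem_boundariesMod_zero.2 ?_⟩
    rw [(F.augLift_homogeneous hv.1).eq_zero_of_neg hm]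
    exact Submodule.zero_mem _
  have h1 := Submodule.finrank_mono this
  have h2 := F.homologyDim_nonneg J 0 m
  rw [homologyDim] at h2 ⊢
  omega

theorem mulRank_zero_eq_source {J : Ideal Poly} {y : Poly} {m : ℤ}
    (h : ∀ f, IsHomogeneousOfDegree f (m - 1) → y * f ∈ I ⊔ J → f ∈ I ⊔ J) :
    F.mulRank J y 0 m = F.homologyDim J 0 (m - 1) := by
  have : part (F.degree 0) (F.boundariesColon J y 0) (m - 1) ≤
      part (F.degree 0) (F.boundariesMod J 0) (m - 1) := by
    refine fun v hv => ⟨hv.1, F.mem_boundariesMod_zero.2 (h _ (F.augLift_homogeneous hv.1) ?_)⟩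
    have h2 : y • v ∈ F.boundariesMod J 0 := hv.2
    rw [mem_boundariesMod_zero, map_smul] at h2
    exact h2
  have h1 := Submodule.finrank_mono this
  have h2 := F.mulRank_le_source J y 0 m
  rw [mulRank, homologyDim] at h2 ⊢
  omega

theorem homologyDim_sup_span_zero_eq_zero {J : Ideal Poly} {y : Poly} {m : ℤ}
    (h : ∀ f, IsHomogeneousOfDegree f m → ∃ f', IsHomogeneousOfDegree f' (m - 1) ∧
      y * f' - f ∈ I) :
    F.homologyDim (J ⊔ Ideal.span {y}) 0 m = 0 := by
  have : part (F.degree 0) (F.cyclesMod (J ⊔ Ideal.span {y}) 0) m ≤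
      part (F.degree 0) (F.boundariesMod (J ⊔ Ideal.span {y}) 0) m := by
    refine fun v hv => ⟨hv.1, F.mem_boundariesMod_zero.2 ?_⟩
    obtain ⟨f', -, h'⟩ := h _ (F.augLift_homogeneous hv.1)
    rw [← sub_sub_cancel (y * f') (F.augLift v)]
    refine Submodule.sub_mem _ (Submodule.mem_sup_right (Submodule.mem_sup_right ?_))
      (Submodule.mem_sup_left h')
    exact Ideal.mul_mem_right _ _ (Ideal.mem_span_singleton_self y)
  have h1 := Submodule.finrank_mono this
  have h2 := F.homologyDim_nonneg (J ⊔ Ideal.span {y}) 0 m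
  rw [homologyDim] at h2 ⊢
  omega

end GradedFreeResolution

end DegreeZero

/-! ### Solving the numerical recursion -/

section Numerics

/-- The `(i + 1)`-st Betti number of `K[z_1, …, z_n] / 𝔪^{d + 1}` over `K[z_1, …, z_p]`. -/
def linearBetti (n d : ℕ) : ℕ → ℕ → ℕ
  | 0, _ => 0
  | p + 1, 0 => linearBetti n d p 0 + (n - p).multichoose d
  | p + 1, i + 1 => linearBetti n d p (i + 1) + linearBetti n d p i

theorem linearBetti_eq_sum (n d p i : ℕ) :
    linearBetti n d p i =
      ∑ q ∈ Finset.range p, (n - q).multichoose d * (p - 1 - q).choose i := by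
  induction p generalizing i with
  | zero => simp [linearBetti]
  | succ p ih =>
    rw [Finset.sum_range_succ]
    cases i with
    | zero => simp [linearBetti, ih]
    | succ i =>
      rw [linearBetti, ih, ih, ← Finset.sum_add_distrib]
      simp only [add_tsub_cancel_right, tsub_self, Nat.choose_zero_succ, mul_zero, add_zero]
      refine Finset.sum_congr rfl fun q hq => ?_
      have hq' := Finset.mem_range.1 hq
      obtain ⟨r, rfl⟩ : ∃ r, p = q + r + 1 := ⟨p - q - 1, by omega⟩
      rw [show q + r + 1 - q = r + 1 by omega, show q + r + 1 - 1 - q = r by omega,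
        Nat.choose_succ_succ]
      ring

theorem sum_choose_mul_choose (n d i : ℕ) :
    ∑ r ∈ Finset.range n, (r + d).choose d * r.choose i =
      (d + i).choose d * (n + d).choose (i + 1 + d) := by
  induction n with
  | zero =>
    rw [Nat.choose_eq_zero_of_lt (show 0 + d < i + 1 + d by omega)]
    simp
  | succ n ih =>
    -- Trinomial revision extracts the constant factor; Pascal's rule then sums the rest.
    have h : (n + d).choose d * n.choose i = (d + i).choose d * (n + d).choose (i + d) := by
      rcases lt_or_ge n i with hi | hi
      · rw [Nat.choose_eq_zero_of_lt hi, Nat.choose_eq_zero_of_lt (show n + d < i + d by omega)]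
        simp
      · have := Nat.choose_mul (n := n + d) (k := i + d) (s := d) (by omega)
        rw [show n + d - d = n by omega, show i + d - d = i by omega] at this
        rw [← this, add_comm d i, mul_comm]
    rw [Finset.sum_range_succ, ih, h, show n + 1 + d = n + d + 1 by omega,
      show i + 1 + d = i + d + 1 by omega, Nat.choose_succ_succ (n + d) (i + d)]
    ring

theorem linearBetti_self (n d i : ℕ) :
    linearBetti n d n i = (d + i).choose d * (n + d).choose (i + 1 + d) := by
  rw [linearBetti_eq_sum, ← sum_choose_mul_choose, ← Finset.sum_range_reflect]
  refine Finset.sum_congr rfl fun r hr => ?_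
  have := Finset.mem_range.1 hr
  rw [show n - (n - 1 - r) = r + 1 by omega, show n - 1 - (n - 1 - r) = r by omega,
    Nat.multichoose_eq, show r + 1 + d - 1 = r + d by omega]

/-- `Nat.multichoose` extended by zero to negative degrees. -/
def multichooseInt (a : ℕ) (m : ℤ) : ℤ := if m < 0 then 0 else a.multichoose m.toNat

theorem multichooseInt_succ (a : ℕ) (m : ℤ) :
    multichooseInt (a + 1) m - multichooseInt (a + 1) (m - 1) = multichooseInt a m := by
  rcases lt_or_ge m 0 with hm | hm
  · simp [multichooseInt, hm, show m - 1 < 0 by omega]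
  · lift m to ℕ using hm
    cases m with
    | zero => simp [multichooseInt]
    | succ m =>
      have h : ¬ ((m + 1 : ℕ) : ℤ) < 0 := by omega
      have h' : ¬ ((m + 1 : ℕ) : ℤ) - 1 < 0 := by omega
      rw [multichooseInt, multichooseInt, multichooseInt, if_neg h, if_neg h', if_neg h,
        show (((m + 1 : ℕ) : ℤ) - 1).toNat = m by omega, Int.toNat_natCast,
        Nat.multichoose_succ_succ]
      push_cast
      ring

/-- Dimensions `h k i m` of the degree `m` part of the `i`-th homology after passing to the quotient
by `k` linear forms, and ranks `r k i m` of multiplication by the next form. -/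
structure HomologyNumerics (n d : ℕ) (h r : ℕ → ℕ → ℤ → ℤ) : Prop where
  zero : ∀ k, k ≤ n → ∀ m, h (k + 1) 0 m + r k 0 m = h k 0 m
  succ : ∀ k, k ≤ n → ∀ i m,
    h (k + 1) (i + 1) m + r k (i + 1) m + r k i m = h k (i + 1) m + h k i (m - 1)
  nonneg : ∀ k, k ≤ n → ∀ i m, 0 ≤ r k i m
  le_source : ∀ k, k ≤ n → ∀ i m, r k i m ≤ h k i (m - 1)
  le_target : ∀ k, k ≤ n → ∀ i m, r k i m ≤ h k i m
  start_succ : ∀ i m, h 0 (i + 1) m = 0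
  start : ∀ m ≤ (d : ℤ), h 0 0 m = multichooseInt (n + 1) m
  injective : ∀ k, k ≤ n → ∀ m ≤ (d : ℤ), r k 0 m = h k 0 (m - 1)
  vanish : ∀ m, (d : ℤ) < m → h 1 0 m = 0

/-- The dimension of the kernel of the first multiplication in degree `t`. -/
def kernelDim (d : ℕ) (h : ℕ → ℕ → ℤ → ℤ) (t : ℤ) : ℤ :=
  if (d : ℤ) ≤ t then h 0 0 t - h 0 0 (t + 1) else 0

variable {n d : ℕ} {h r : ℕ → ℕ → ℤ → ℤ}

/-- Injectivity makes each stage the first difference of the previous one, which removes one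
variable from a polynomial ring. -/
theorem HomologyNumerics.zero_of_le (H : HomologyNumerics n d h r) {k : ℕ} (hk : k ≤ n + 1)
    {m : ℤ} (hm : m ≤ d) : h k 0 m = multichooseInt (n + 1 - k) m := by
  induction k generalizing m with
  | zero => exact H.start m hm
  | succ k ih =>
    have h1 := H.zero k (by omega) m
    rw [H.injective k (by omega) m hm, ih (by omega) hm, ih (by omega) (by omega),
      show n + 1 - k = n - k + 1 by omega] at h1
    have h2 := multichooseInt_succ (n - k) m
    rw [show n + 1 - (k + 1) = n - k by omega]
    omega

theorem HomologyNumerics.zero_of_lt (H : HomologyNumerics n d h r) {p : ℕ} (hp : p ≤ n)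
    {m : ℤ} (hm : d < m) : h (p + 1) 0 m = 0 := by
  induction p with
  | zero => exact H.vanish m hm
  | succ p ih =>
    have h1 := H.zero (p + 1) (by omega) m
    have h2 := H.nonneg (p + 1) (by omega) 0 m
    have h3 := H.le_target (p + 1) (by omega) 0 m
    have h4 := ih (by omega)
    omega

theorem HomologyNumerics.mulRank_zero_of_lt (H : HomologyNumerics n d h r) {p : ℕ}
    (hp : p + 1 ≤ n) {m : ℤ} (hm : d < m) : r (p + 1) 0 m = 0 := by
  have h2 := H.nonneg (p + 1) (by omega) 0 m
  have h3 := H.le_target (p + 1) (by omega) 0 m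
  rw [H.zero_of_lt (by omega) hm] at h3
  omega

/-- The hypothesis `hker` says that the degrees in which `g` has a kernel are isolated and stay away
from `d`. This makes all later ranks on positive homology vanish. -/
theorem HomologyNumerics.homology_succ (H : HomologyNumerics n d h r)
    (hker : ∀ t, kernelDim d h t ≠ 0 → (d : ℤ) + 2 ≤ t ∧ kernelDim d h (t + 1) = 0)
    {p : ℕ} (hp : p ≤ n) (i : ℕ) (m : ℤ) :
    h (p + 1) (i + 1) m = (if m = i + 1 + d then (linearBetti n d p i : ℤ) else 0) +
      kernelDim d h (m - (i + 1)) * (p.choose i : ℤ) := by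
  induction p generalizing i m with
  | zero =>
    have hr : ∀ j m, r 0 (j + 1) m = 0 := fun j m => by
      have h1 := H.nonneg 0 (by omega) (j + 1) m
      have h2 := H.le_target 0 (by omega) (j + 1) m
      rw [H.start_succ] at h2
      omega
    have h1 := H.succ 0 (by omega) i m
    rw [hr, H.start_succ] at h1
    cases i with
    | zero =>
      have h2 := H.zero 0 (by omega) m
      simp only [linearBetti, Nat.cast_zero, ite_self, Nat.choose_self, Nat.cast_one, mul_one,
        zero_add, kernelDim] at h1 h2 ⊢
      -- From degree `d` on the multiplication is onto, so its kernel is a difference of Hilbert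
      -- function values; below `d` it is injective.
      split_ifs with hm
      · have h3 := H.vanish m (by omega)
        rw [sub_add_cancel]
        omega
      · have h3 := H.injective 0 (by omega) m (by omega)
        omega
    | succ i =>
      rw [hr, H.start_succ] at h1
      simp only [linearBetti, Nat.cast_zero, ite_self, Nat.choose_zero_succ, mul_zero]
      simp only [zero_add, add_zero] at h1 ⊢
      exact h1
  | succ p ih =>
    have hr : ∀ j m, r (p + 1) (j + 1) m = 0 := by
      intro j m
      have h1 := H.nonneg (p + 1) (by omega) (j + 1) m
      have h2 := H.le_target (p + 1) (by omega) (j + 1) m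
      have h3 := H.le_source (p + 1) (by omega) (j + 1) m
      rw [ih (by omega)] at h2 h3
      by_contra hne
      have hs : m - 1 = j + 1 + d ∨ kernelDim d h (m - 1 - (j + 1)) ≠ 0 := by
        by_contra! hcon
        rw [if_neg hcon.1, hcon.2] at h3
        omega
      have ht : m = j + 1 + d ∨ kernelDim d h (m - (j + 1)) ≠ 0 := by
        by_contra! hcon
        rw [if_neg hcon.1, hcon.2] at h2
        omega
      -- A nonzero rank needs source and target both nonzero, hence two consecutive degrees in the
      -- support. The mixed cases would put the kernel of `g` in degree `d + 1` or `d - 1`.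
      rcases hs with hs | hs
      · rcases ht with ht | ht
        · omega
        · have := (hker _ ht).1
          omega
      · have h4 := hker _ hs
        rw [show m - 1 - ((j : ℤ) + 1) + 1 = m - (j + 1) by ring] at h4
        rcases ht with ht | ht
        · omega
        · exact ht h4.2
    have h1 := H.succ (p + 1) (by omega) i m
    rw [hr, ih (by omega) i m] at h1
    cases i with
    | zero =>
      simp only [linearBetti, Nat.cast_zero, zero_add, Nat.choose_zero_right] at h1 ⊢
      -- The kernel on `H_0` is zero below degree `d`, all of `H_0` in degree `d`, and zero above
      -- because `H_0` vanishes there.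
      rcases lt_trichotomy (m - 1) d with hm | hm | hm
      · rw [H.injective (p + 1) (by omega) m (by omega)] at h1
        rw [if_neg (by omega)] at h1 ⊢
        omega
      · rw [H.mulRank_zero_of_lt (by omega) (by omega), H.zero_of_le (by omega) hm.le] at h1
        rw [if_pos (by omega)] at h1 ⊢
        rw [multichooseInt, if_neg (by omega), show (m - 1).toNat = d by omega,
          show n + 1 - (p + 1) = n - p by omega] at h1
        push_cast
        omega
      · rw [H.mulRank_zero_of_lt (by omega) (by omega), H.zero_of_lt (by omega) hm] at h1
        rw [if_neg (by omega)] at h1 ⊢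
        omega
    | succ i =>
      rw [hr, ih (by omega) i (m - 1)] at h1
      rw [linearBetti, Nat.choose_succ_succ]
      have e : m - 1 - ((i : ℤ) + 1) = m - (((i + 1 : ℕ) : ℤ) + 1) := by push_cast; ring
      have e' : (m - 1 = (i : ℤ) + 1 + d) = (m = ((i + 1 : ℕ) : ℤ) + 1 + d) := by
        rw [eq_iff_iff]
        push_cast
        omega
      simp only [e, e'] at h1
      split_ifs at h1 ⊢ <;> push_cast at h1 ⊢ <;> linarith

end Numerics

/-! ### Where the Hilbert function drops -/

section Shape

variable {h : ℕ → ℕ} {s ℓ : ℕ} {u : ℕ → ℕ}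

theorem HasShape.exists_plateau (hu : HasShape h s ℓ u) {j : ℕ} (hj : u 1 ≤ j) (hjs : j ≤ s) :
    ∃ k, 1 ≤ k ∧ k ≤ ℓ ∧ u k ≤ j ∧ j < u (k + 1) := by
  have key : ∀ K, K ≤ ℓ → j < u (K + 1) → ∃ k, 1 ≤ k ∧ k ≤ ℓ ∧ u k ≤ j ∧ j < u (k + 1) := by
    intro K
    induction K with
    | zero => exact fun _ h => absurd h hj.not_gt
    | succ K ih =>
      intro hK h
      rcases lt_or_ge j (u (K + 1)) with hlt | hge
      · exact ih (by omega) hlt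
      · exact ⟨K + 1, by omega, hK, hge, h⟩
  exact key ℓ le_rfl (by rw [hu.last]; omega)

theorem HasShape.step (hu : HasShape h s ℓ u) {j : ℕ} (hj : u 1 ≤ j) :
    h (j + 1) = h j ∨ h (j + 1) < h j ∧ ∃ k, 2 ≤ k ∧ k ≤ ℓ + 1 ∧ u k = j + 1 := by
  rcases lt_or_ge s j with hs | hs
  · left
    rw [hu.vanish j hs, hu.vanish (j + 1) (by omega)]
  · obtain ⟨k, hk1, hk, hkj, hjk⟩ := hu.exists_plateau hj hs
    have h1 := hu.plateau k hk1 hk j hkj hjk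
    rcases Nat.lt_or_ge (j + 1) (u (k + 1)) with hlt | hge
    · left
      rw [h1, hu.plateau k hk1 hk (j + 1) (by omega) hlt]
    · right
      have e : u (k + 1) = j + 1 := by omega
      have := hu.drop k hk1 hk
      rw [e] at this
      exact ⟨by omega, k + 1, by omega, by omega, e⟩

theorem add_le_of_gaps (hgap : ∀ k, 2 ≤ k → k ≤ ℓ → u k + 2 ≤ u (k + 1)) {k k' : ℕ} (hk : 2 ≤ k)
    (hkk' : k < k') (hk' : k' ≤ ℓ + 1) : u k + 2 ≤ u k' := by
  induction k' with
  | zero => omega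
  | succ k' ih =>
    have h1 := hgap k' (by omega) (by omega)
    rcases Nat.lt_or_ge k k' with h | h
    · have := ih h (by omega)
      omega
    · obtain rfl : k = k' := by omega
      exact h1

end Shape

/-! ### From the Weak Lefschetz property to the numerical relations -/

section Betti

variable {K : Type*} [Field K] {n : ℕ}

local notation "Poly" => MvPolynomial (Fin (n + 1)) K

theorem HasWeakLefschetz.exists_linear_form {I : Ideal Poly} (hwlp : HasWeakLefschetz I)
    (h0 : hilbertFunction I 0 ≠ 0) (h1 : hilbertFunction I 1 ≠ 0) :
    ∃ f : Poly, f.IsHomogeneous 1 ∧ f ≠ 0 ∧ ∀ j : ℕ,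
      (∀ a, IsHomogeneousOfDegree a (j : ℤ) → f * a ∈ I → a ∈ I) ∨
      (∀ b, IsHomogeneousOfDegree b ((j + 1 : ℕ) : ℤ) →
        ∃ a, IsHomogeneousOfDegree a (j : ℤ) ∧ f * a - b ∈ I) := by
  obtain ⟨g, hg, hwlp⟩ := hwlp
  obtain ⟨f, hf, rfl⟩ := mem_piece.1 hg
  refine ⟨f, isHomogeneousOfDegree_natCast.1 hf, ?_, fun j => ?_⟩
  -- Multiplication by zero has maximal rank from degree 0 to degree 1 only if one of the two pieces
  -- is zero.
  · rintro rfl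
    rcases hwlp 0 with h | h
    · apply h0
      rw [hilbertFunction, (Submodule.eq_bot_iff _).2 fun a ha => h a ha (by simp), finrank_bot]
    · apply h1
      rw [hilbertFunction, (Submodule.eq_bot_iff (piece I 1)).2 fun b hb => ?_, finrank_bot]
      obtain ⟨a, -, rfl⟩ := h b hb
      simp
  · refine (hwlp j).imp (fun h a ha hfa => ?_) fun h b hb => ?_
    · rw [← Ideal.Quotient.eq_zero_iff_mem] at hfa ⊢
      rw [map_mul] at hfa
      exact h _ (mem_piece.2 ⟨a, ha, rfl⟩) hfa
    · obtain ⟨a', ha', e⟩ := h _ (mem_piece.2 ⟨b, hb, rfl⟩)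
      obtain ⟨a, ha, rfl⟩ := mem_piece.1 ha'
      exact ⟨a, ha, by rw [← Ideal.Quotient.eq, map_mul, e]⟩

/-- As `I` is zero in degree `m`, the degree `m` component of `y * f` lies in `J` alone, and
regularity applies. -/
theorem mem_sup_of_mul_mem_sup {I J : Ideal Poly} (hI : IsGradedIdeal I) (hJ : IsGradedIdeal J)
    {y : Poly} (hy : IsHomogeneousOfDegree y 1) (hreg : ∀ f, y * f ∈ J → f ∈ J) {m : ℤ}
    (hIm : ∀ f ∈ I, IsHomogeneousOfDegree f m → f = 0) {f : Poly}
    (hf : IsHomogeneousOfDegree f (m - 1)) (hyf : y * f ∈ I ⊔ J) : f ∈ I ⊔ J := by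
  obtain ⟨a, ha, c, hc, e⟩ := Submodule.mem_sup.1 hyf
  have hm : IsHomogeneousOfDegree (y * f) m := by
    have := hy.mul hf
    rwa [add_sub_cancel] at this
  refine Submodule.mem_sup_right (hreg f ?_)
  rw [← comp_of_mem hm, ← e, map_add, hIm _ (hI a ha m) (comp_mem m a), zero_add]
  exact hJ c hc m

theorem homologyNumerics {I : Ideal Poly} (hI : IsGradedIdeal I) (F : GradedFreeResolution I)
    {d : ℕ} {y : ℕ → Poly} (hy : IsLinearSystem y)
    (hmax : ∀ j, j ≤ d → hilbertFunction I j = (n + j).choose n)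
    (hanti : ∀ j, d ≤ j → hilbertFunction I (j + 1) ≤ hilbertFunction I j)
    (hrank : ∀ j : ℕ, (∀ a, IsHomogeneousOfDegree a (j : ℤ) → y 0 * a ∈ I → a ∈ I) ∨
      (∀ b, IsHomogeneousOfDegree b ((j + 1 : ℕ) : ℤ) →
        ∃ a, IsHomogeneousOfDegree a (j : ℤ) ∧ y 0 * a - b ∈ I)) :
    HomologyNumerics n d (fun k => F.homologyDim (initialIdeal y k))
      (fun k => F.mulRank (initialIdeal y k) (y k)) where
  zero k _ m := F.homologyDim_sup_span_zero (hy.isGradedIdeal k) (hy.homogeneous k) m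
  succ k hk i m :=
    F.homologyDim_sup_span_succ (hy.isGradedIdeal k) (hy.homogeneous k) (hy.regular k hk) i m
  nonneg k hk i m := F.mulRank_nonneg (hy.regular k hk) i m
  le_source k _ i m := F.mulRank_le_source _ _ i m
  le_target k hk i m := F.mulRank_le_target (hy.homogeneous k) (hy.regular k hk) i m
  start_succ i m := F.homologyDim_bot_succ i m
  start m hm := by
    change F.homologyDim ⊥ 0 m = _
    rcases lt_or_ge m 0 with h | h
    · rw [F.homologyDim_zero_of_neg _ h, multichooseInt, if_pos h]
    · lift m to ℕ using h
      rw [F.homologyDim_bot_zero_natCast hI, hmax m (by omega), multichooseInt, if_neg (by omega),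
        Int.toNat_natCast, Nat.multichoose_eq, show n + 1 + m - 1 = n + m by omega,
        Nat.choose_symm_add]
  injective k hk m hm := by
    refine F.mulRank_zero_eq_source fun f hf hyf =>
      mem_sup_of_mul_mem_sup hI (hy.isGradedIdeal k) (hy.homogeneous k) (hy.regular k hk)
        (fun a ha ham => ?_) hf hyf
    rcases lt_or_ge m 0 with h | h
    · exact ham.eq_zero_of_neg h
    · lift m to ℕ using h
      exact eq_zero_of_mem_of_finrank_piece (hmax m (by omega))
        (isHomogeneousOfDegree_natCast.1 ham) ha
  vanish m hm := by
    obtain ⟨j, rfl⟩ : ∃ j : ℕ, m = ((j + 1 : ℕ) : ℤ) := ⟨(m - 1).toNat, by omega⟩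
    have e : ((j + 1 : ℕ) : ℤ) - 1 = j := by push_cast; ring
    -- In the injective case the Hilbert function does not increase from `j` to `j + 1`, so
    -- injectivity already forces surjectivity.
    rcases hrank j with h | h
    · have h1 : F.mulRank ⊥ (y 0) 0 ((j + 1 : ℕ) : ℤ) = F.homologyDim ⊥ 0 j := by
        rw [F.mulRank_zero_eq_source, e]
        intro f hf hyf
        rw [e] at hf
        rw [sup_bot_eq] at hyf ⊢
        exact h f hf hyf
      have h2 := F.homologyDim_sup_span_zero IsGradedIdeal.bot (hy.homogeneous 0)
        ((j + 1 : ℕ) : ℤ)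
      have h3 := F.homologyDim_nonneg (⊥ ⊔ Ideal.span {y 0}) 0 ((j + 1 : ℕ) : ℤ)
      have h4 := hanti j (by omega)
      rw [h1, F.homologyDim_bot_zero_natCast hI, F.homologyDim_bot_zero_natCast hI] at h2
      change F.homologyDim (⊥ ⊔ Ideal.span {y 0}) 0 _ = 0
      omega
    · refine F.homologyDim_sup_span_zero_eq_zero (J := ⊥) fun f hf => ?_
      rw [e]
      exact h f hf

end Betti

end GradedBetti

/-! ### The graded Betti numbers -/

theorem corollary3p14 {K : Type*} [Field K] {n : ℕ}
    (I : Ideal (MvPolynomial (Fin (n + 1)) K))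
    (hI : I.IsHomogeneous (MvPolynomial.homogeneousSubmodule (Fin (n + 1)) K))
    (hart : IsArtinianRing (MvPolynomial (Fin (n + 1)) K ⧸ I))
    (hwlp : GradedBetti.HasWeakLefschetz I)
    (s ℓ : ℕ) (u : ℕ → ℕ)
    (hu : GradedBetti.HasShape (GradedBetti.hilbertFunction I) s ℓ u)
    (hmax : ∀ j, j ≤ u 1 → GradedBetti.hilbertFunction I j = (n + j).choose n)
    (hgap_one : u 1 + 3 ≤ u 2)
    (hgap : ∀ k, 2 ≤ k → k ≤ ℓ → u k + 2 ≤ u (k + 1))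
    (F : GradedBetti.GradedFreeResolution I) :
    (∀ m : ℤ, F.tor 0 m = if m = 0 then 1 else 0) ∧
    ∀ (i : ℕ) (j : ℤ), 1 ≤ i →
      (j = u 1 →
        F.tor i (i + j) = (u 1 + i - 1).choose (u 1) * (n + u 1).choose (i + u 1)) ∧
      (∀ k, 2 ≤ k → k ≤ ℓ + 1 → j = (u k : ℤ) - 1 →
        (F.tor i (i + j) : ℤ) =
          -GradedBetti.firstDifference (GradedBetti.hilbertFunction I) (u k) *
            (n.choose (i - 1) : ℤ)) ∧
      (j ≠ u 1 → (∀ k, 2 ≤ k → k ≤ ℓ + 1 → j ≠ (u k : ℤ) - 1) →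
        F.tor i (i + j) = 0) := by
  open GradedBetti in
  have hI' := isGradedIdeal_of_isHomogeneous hI
  have h0 : hilbertFunction I 0 ≠ 0 := by
    rw [hmax 0 (Nat.zero_le _)]
    simp
  have h1 : hilbertFunction I 1 ≠ 0 := by
    rcases Nat.eq_zero_or_pos (u 1) with h | h
    · rw [hu.plateau 1 le_rfl hu.one_le 1 (by omega) (lt_of_lt_of_le (by omega) hgap_one), h]
      exact h0
    · rw [hmax 1 h]
      simp
  obtain ⟨f, hf, hf0, hrank⟩ := hwlp.exists_linear_form h0 h1
  obtain ⟨y, hy, rfl⟩ := exists_isLinearSystem hf hf0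
  have hanti : ∀ j, u 1 ≤ j → hilbertFunction I (j + 1) ≤ hilbertFunction I j := fun j hj => by
    rcases hu.step hj with h | h
    · exact h.le
    · exact h.1.le
  have H := homologyNumerics hI' F hy hmax hanti hrank
  set h : ℕ → ℕ → ℤ → ℤ := fun k => F.homologyDim (initialIdeal y k) with hh
  have htor : ∀ i m, (F.tor i m : ℤ) = h (n + 1) i m := fun i m =>
    F.tor_eq_homologyDim hy.irrelevant i m
  have hstart : ∀ j : ℕ, h 0 0 (j : ℤ) = hilbertFunction I j := fun j =>
    F.homologyDim_bot_zero_natCast hI' j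
  have hgap_two : ∀ k, 2 ≤ k → k ≤ ℓ + 1 → u 1 + 3 ≤ u k := fun k hk hk' => by
    rcases Nat.eq_or_lt_of_le hk with rfl | hlt
    · exact hgap_one
    · have := add_le_of_gaps hgap le_rfl hlt hk'
      omega
  have hker : ∀ t, kernelDim (u 1) h t ≠ 0 → ∃ k, 2 ≤ k ∧ k ≤ ℓ + 1 ∧ (u k : ℤ) = t + 1 := by
    intro t ht
    rw [kernelDim] at ht
    split_ifs at ht with hut
    · lift t to ℕ using (by omega)
      have e : (t : ℤ) + 1 = (t + 1 : ℕ) := by push_cast; ring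
      rw [e, hstart, hstart] at ht
      rcases hu.step (j := t) (by omega) with h | ⟨-, k, hk, hk', huk⟩
      · omega
      · exact ⟨k, hk, hk', by omega⟩
    · exact absurd rfl ht
  -- The kernel of `g` lives in degrees `u k - 1`: `u 1 + 3 ≤ u 2` keeps them at least `u 1 + 2`,
  -- and the other gaps keep them from being consecutive.
  have hmain := H.homology_succ (fun t ht => by
    obtain ⟨k, hk, hk', huk⟩ := hker t ht
    have := hgap_two k hk hk'
    refine ⟨by omega, ?_⟩
    by_contra ht'
    obtain ⟨k₁, hk₁, hk₁', huk₁⟩ := hker _ ht'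
    rcases lt_trichotomy k k₁ with hlt | rfl | hlt
    · have := add_le_of_gaps hgap hk hlt hk₁'
      omega
    · omega
    · have := add_le_of_gaps hgap hk₁ hlt hk'
      omega) le_rfl
  refine ⟨fun m => ?_, fun i j hi => ?_⟩
  · have e := htor 0 m
    rcases le_or_gt m (u 1 : ℤ) with hm | hm
    -- After all `n + 1` forms no variable is left, so only degree zero survives.
    · rw [H.zero_of_le le_rfl hm, Nat.sub_self, multichooseInt] at e
      rcases lt_trichotomy m 0 with hm0 | rfl | hm0
      · rw [if_pos hm0] at e
        rw [if_neg hm0.ne]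
        exact_mod_cast e
      · simpa using e
      · rw [if_neg (by omega), show m.toNat = (m.toNat - 1) + 1 by omega,
          Nat.multichoose_zero_succ] at e
        rw [if_neg hm0.ne']
        exact_mod_cast e
    · rw [H.zero_of_lt le_rfl hm] at e
      rw [if_neg (by omega)]
      exact_mod_cast e
  · obtain ⟨i, rfl⟩ : ∃ i', i = i' + 1 := ⟨i - 1, by omega⟩
    have e := htor (i + 1) (((i + 1 : ℕ) : ℤ) + j)
    rw [hmain, show ((i + 1 : ℕ) : ℤ) + j - ((i : ℤ) + 1) = j by push_cast; ring,
      linearBetti_self] at e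
    refine ⟨fun hj => ?_, fun k hk hk' hj => ?_, fun hj hj' => ?_⟩
    · have hz : kernelDim (u 1) h j = 0 := by
        by_contra hne
        obtain ⟨k, hk, hk', huk⟩ := hker j hne
        have := hgap_two k hk hk'
        omega
      rw [if_pos (by push_cast; omega), hz, zero_mul, add_zero] at e
      rw [show u 1 + (i + 1) - 1 = u 1 + i by omega]
      exact_mod_cast e
    · have huk := hgap_two k hk hk'
      rw [if_neg (by push_cast; omega), zero_add, kernelDim, if_pos (by omega), hj,
        sub_add_cancel, hstart, show (u k : ℤ) - 1 = ((u k - 1 : ℕ) : ℤ) by omega, hstart] at e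
      rw [hj, show (u k : ℤ) - 1 = ((u k - 1 : ℕ) : ℤ) by omega, e, firstDifference,
        if_neg (by omega), Nat.add_sub_cancel, neg_sub]
    · have hz : kernelDim (u 1) h j = 0 := by
        by_contra hne
        obtain ⟨k, hk, hk', huk⟩ := hker j hne
        exact hj' k hk hk' (by omega)
      rw [if_neg (by push_cast; omega), hz, zero_mul, add_zero] at e
      exact_mod_cast e
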